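/- Let $p$ be a prime, $k$ a field of characteristic $p$ (not necessarily algebraically closed), $G$ a finite group and $N$ a normal subgroup of $G$. For a $G$-algebra $A$ over $k$ and subgroups $K\le H\le G$ write $A^H$ for the subalgebra of $H$-fixed elements, $A_K^H=\operatorname{Tr}_K^H(A^K)$, $A(H)=A^H/\sum_{K<H}A_K^H$, and $\operatorname{Br}_H:A^H\to A(H)$ for the quotient map. The algebra $A$ is a $p$-permutation $G$-algebra if for every $p$-subgroup $P$ of $G$ it has a finite $P$-stable $k$-basis. A point of $A^H$ is an $(A^H)^{\times}$-conjugacy class of primitive idempotents; a defect group of a point $\alpha$ of $A^H$ (or of a primitive idempotent of $A^H$) is a minimal subgroup $P\le H$ such that $A_P^H$ contains $\alpha$ (or the idempotent). A block of a ring is a primitive idempotent of its center. Let $A$ be a $p$-permutation $G$-algebra and $C\subseteq A$ a $G$-stable subalgebra (not necessarily with the same identity; as a $k$-subspace it is a direct summand) which is a $p$-permutation $N$-interior $G$-algebra. Let $c$ be a $G$-invariant primitive idempotent of $C^N$ and $Q\le N$ a defect group of $c$ in $N$. A $(C,c,G)$-Brauer pair is a pair $(R,f_R)$ of a $p$-subgroup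 $R$ of $G$ and a block $f_R$ of $C(R)$ with $\operatorname{Br}_R(c)f_R\ne 0$; and $(R,f_R)\le (S,f_S)$ means that $R\le S$ and that every primitive idempotent $i$ of $C^S$ with $\operatorname{Br}_S(i)f_S\ne 0$ satisfies $\operatorname{Br}_R(i)f_R\neq 0$. Let $(Q,f_Q)$ be a $(C,c,G)$-Brauer pair such that $f_Q$ is a primitive idempotent of $C(Q)^{C_N(Q)}$, and let $F_1$ be the set of all $(C,c,G)$-Brauer pairs $(R,f_R)$ with $(Q,f_Q)\le (R,f_R)$. Let $\alpha$ be a point of $A^G$ that covers $c$, that is, there are $i\in\alpha$ and a point $\epsilon$ of $A^N$ with defect group $Q$ such that $ic=ci=i$, such that $if=fi=f$ for some $f\in\epsilon$, and such that $cf_1=f_1c=f_1$ for some $f_1\in\epsilon$. Then there is a defect group $P$ of $\alpha$ with $P\cap N=Q$, and there is a block $f_P$ of $C(P)$ such that $(P,f_P)\in F_1$. -/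

import Mathlib

namespace PermAlg

/-! ### Primitive idempotents, blocks and points of a ring -/

/-- A primitive idempotent: a nonzero idempotent that is not the sum of two nonzero orthogonal
idempotents. -/
def IsPrimitiveIdem {R : Type*} [Ring R] (e : R) : Prop :=
  IsIdempotentElem e ∧ e ≠ 0 ∧
    ∀ x y : R, IsIdempotentElem x → IsIdempotentElem y → x * y = 0 → y * x = 0 →
      x + y = e → x = 0 ∨ y = 0

/-- A block of a ring: a primitive idempotent of its center. -/
def IsBlock {R : Type*} [Ring R] (e : R) : Prop :=
  ∃ h : e ∈ Subring.center R, IsPrimitiveIdem (⟨e, h⟩ : Subring.center R)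

/-- A point of a ring: a conjugacy class, under the group of units, of primitive idempotents. -/
def IsPoint {R : Type*} [Ring R] (α : Set R) : Prop :=
  ∃ i : R, IsPrimitiveIdem i ∧ α = {j | ∃ u : Rˣ, j = u * i * (u⁻¹ : Rˣ)}

section GAlgebra

variable {G : Type*} [Group G]
variable (A : Type*) [Ring A] [MulSemiringAction G A]

/-- The subring `A^H` of the elements of `A` fixed by the subgroup `H`. -/
abbrev Fix (H : Subgroup G) : Subring A := FixedPoints.subring A H

variable {A}

theorem mem_Fix {H : Subgroup G} {a : A} : a ∈ Fix A H ↔ ∀ h ∈ H, h • a = a :=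
  ⟨fun ha h hh => ha ⟨h, hh⟩, fun ha h => ha h h.2⟩

theorem Fix_anti {K H : Subgroup G} (h : K ≤ H) : Fix A H ≤ Fix A K :=
  fun _ ha => mem_Fix.2 fun x hx => mem_Fix.1 ha x (h hx)

/-- The inclusion `A^H → A^K` for `K ≤ H`. -/
def res {K H : Subgroup G} (h : K ≤ H) : Fix A H →+* Fix A K := Subring.inclusion (Fix_anti h)

/-- The relative trace `Tr_K^H(a) = ∑_{x ∈ H/K} x • a`, meant for `K ≤ H` and `a ∈ A^K`, in which
case it does not depend on the representatives. -/
noncomputable def relTrace (K H : Subgroup G) (a : A) : A :=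
  ∑ᶠ x : H ⧸ K.subgroupOf H, ((x.out : H) : G) • a

theorem smul_out {K H : Subgroup G} {a : A} (ha : a ∈ Fix A K) (h : H) :
    (((QuotientGroup.mk h : H ⧸ K.subgroupOf H).out : H) : G) • a = (h : G) • a := by
  obtain ⟨⟨k, hk⟩, e⟩ := QuotientGroup.mk_out_eq_mul (K.subgroupOf H) h
  rw [e]
  have hk' : (k : G) ∈ K := hk
  simp only [Subgroup.coe_mul, mul_smul]
  rw [mem_Fix.1 ha _ hk']

theorem smul_mem_Fix {P : Subgroup G} {g : G} (hg : g ∈ Subgroup.normalizer (P : Set G)) {a : A}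
    (ha : a ∈ Fix A P) : g • a ∈ Fix A P := by
  rw [mem_Fix]
  intro x hx
  have h := mem_Fix.1 ha (g⁻¹ * x * g) ((Subgroup.mem_normalizer_iff''.1 hg x).1 hx)
  calc x • g • a = g • (g⁻¹ * x * g) • a := by simp only [smul_smul]; congr 1; group
    _ = g • a := by rw [h]

/-- The action of `g ∈ N_G(P)` on `A^P`. -/
def conjFix (P : Subgroup G) (g : Subgroup.normalizer (P : Set G)) : Fix A P →+* Fix A P :=
  (((MulSemiringAction.toRingHom G A (g : G)).comp (Fix A P).subtype).codRestrict (Fix A P)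
    fun x => smul_mem_Fix g.2 x.2)

theorem coe_conjFix (P : Subgroup G) (g : Subgroup.normalizer (P : Set G)) (x : Fix A P) :
    ((conjFix P g x : Fix A P) : A) = (g : G) • (x : A) := rfl

variable [Finite G]

theorem smul_relTrace (g : G) (K H : Subgroup G) (a : A) :
    g • relTrace K H a = ∑ᶠ x : H ⧸ K.subgroupOf H, g • ((x.out : H) : G) • a := by
  unfold relTrace
  exact (DistribSMul.toAddMonoidHom A g).map_finsum (Set.toFinite _)

theorem relTrace_mem {K H : Subgroup G} {a : A} (ha : a ∈ Fix A K) :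
    relTrace K H a ∈ Fix A H := by
  rw [mem_Fix]
  intro h hh
  rw [smul_relTrace, relTrace]
  refine finsum_eq_of_bijective (fun x => (⟨h, hh⟩ : H) • x) (MulAction.bijective _) ?_
  intro x
  have e : (⟨h, hh⟩ : H) • x = QuotientGroup.mk ((⟨h, hh⟩ : H) * x.out) := by
    conv_lhs => rw [← QuotientGroup.out_eq' x]
    rfl
  rw [e, smul_out ha, Subgroup.coe_mul, mul_smul]

theorem relTrace_add (K H : Subgroup G) (a b : A) :
    relTrace K H (a + b) = relTrace K H a + relTrace K H b := by
  simp only [relTrace, smul_add]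
  exact finsum_add_distrib (Set.toFinite _) (Set.toFinite _)

theorem relTrace_mul_left (K : Subgroup G) {H : Subgroup G} {b : A} (hb : b ∈ Fix A H) (a : A) :
    relTrace K H (b * a) = b * relTrace K H a := by
  unfold relTrace
  refine Eq.trans (finsum_congr fun x => ?_)
    ((AddMonoidHom.mulLeft b).map_finsum (Set.toFinite _)).symm
  change _ = b * _
  rw [smul_mul', mem_Fix.1 hb _ x.out.2]

theorem relTrace_mul_right (K : Subgroup G) {H : Subgroup G} {b : A} (hb : b ∈ Fix A H) (a : A) :
    relTrace K H (a * b) = relTrace K H a * b := by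
  unfold relTrace
  refine Eq.trans (finsum_congr fun x => ?_)
    ((AddMonoidHom.mulRight b).map_finsum (Set.toFinite _)).symm
  change _ = _ * b
  rw [smul_mul', mem_Fix.1 hb _ x.out.2]

variable (A)

/-- The ideal `A_K^H = Tr_K^H(A^K)` of `A^H`, for `K ≤ H`. -/
def traceIdeal {K H : Subgroup G} (hKH : K ≤ H) : Ideal (Fix A H) where
  carrier := {x | ∃ a ∈ Fix A K, (x : A) = relTrace K H a}
  zero_mem' := ⟨0, zero_mem _, by simp [relTrace]⟩
  add_mem' := by
    rintro x y ⟨a, ha, hx⟩ ⟨b, hb, hy⟩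
    exact ⟨a + b, add_mem ha hb, by rw [relTrace_add, ← hx, ← hy]; rfl⟩
  smul_mem' := by
    rintro y x ⟨a, ha, hx⟩
    refine ⟨y * a, mul_mem (Fix_anti hKH y.2) ha, ?_⟩
    rw [relTrace_mul_left K y.2, ← hx]; rfl

/-- The ideal `∑_{K < P} A_K^P` of `A^P`, the kernel of the Brauer map. -/
def brauerIdeal (P : Subgroup G) : Ideal (Fix A P) :=
  ⨆ K : {K : Subgroup G // K < P}, traceIdeal A K.2.le

variable {A}

theorem mul_mem_traceIdeal {K H : Subgroup G} (hKH : K ≤ H) {x : Fix A H}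
    (hx : x ∈ traceIdeal A hKH) (y : Fix A H) : x * y ∈ traceIdeal A hKH := by
  obtain ⟨a, ha, hx⟩ := hx
  refine ⟨a * y, mul_mem ha (Fix_anti hKH y.2), ?_⟩
  rw [relTrace_mul_right K y.2, ← hx]; rfl

instance brauerIdeal_isTwoSided (P : Subgroup G) : (brauerIdeal A P).IsTwoSided where
  mul_mem_of_left {x} y hx := by
    unfold brauerIdeal at hx ⊢
    induction hx using Submodule.iSup_induction' with
    | mem K x hx => exact Submodule.mem_iSup_of_mem K (mul_mem_traceIdeal _ hx y)
    | zero => rw [zero_mul]; exact zero_mem _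
    | add x x' _ _ h h' => rw [add_mul]; exact add_mem h h'

variable (A)

/-- The Brauer quotient `A(P) = A^P / ∑_{K < P} A_K^P`. -/
abbrev BrauerQuotient (P : Subgroup G) : Type _ := Fix A P ⧸ brauerIdeal A P

variable {A}

/-- The Brauer map `Br_P : A^P → A(P)`. -/
def Br (P : Subgroup G) : Fix A P →+* BrauerQuotient A P := Ideal.Quotient.mk (brauerIdeal A P)

/-! ### The action of `N_G(P)` on `A(P)` -/

theorem smul_relTrace_conj {P K : Subgroup G} {g : G}
    (hg : g ∈ Subgroup.normalizer (P : Set G)) {a : A} (ha : a ∈ Fix A K) :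
    g • relTrace K P a = relTrace (K.map (MulAut.conj g).toMonoidHom) P (g • a) := by
  have hga : g • a ∈ Fix A (K.map (MulAut.conj g).toMonoidHom) := by
    rw [mem_Fix]
    rintro _ ⟨k, hk, rfl⟩
    have e : (MulAut.conj g).toMonoidHom k * g = g * k := by simp
    rw [smul_smul, e, mul_smul, mem_Fix.1 ha k hk]
  let φ : P ≃* P := P.normalizerMonoidHom ⟨g, hg⟩
  have hφ : ∀ x : P, ((φ x : P) : G) = g * x * g⁻¹ := fun x => rfl
  let e : P ⧸ K.subgroupOf P ≃ P ⧸ (K.map (MulAut.conj g).toMonoidHom).subgroupOf P :=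
    Quotient.congr φ.toEquiv fun x y => by
      change (QuotientGroup.leftRel _) x y ↔ (QuotientGroup.leftRel _) (φ x) (φ y)
      rw [QuotientGroup.leftRel_apply, QuotientGroup.leftRel_apply, ← map_inv, ← map_mul,
        Subgroup.mem_subgroupOf, Subgroup.mem_subgroupOf, hφ]
      constructor
      · exact fun h => ⟨_, h, rfl⟩
      · rintro ⟨k, hk, h⟩
        have h' : g * k * g⁻¹ = g * ((x⁻¹ * y : P) : G) * g⁻¹ := h
        have : k = ((x⁻¹ * y : P) : G) := by simpa using h'
        exact this ▸ hk
  rw [smul_relTrace, relTrace]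
  refine finsum_eq_of_bijective e e.bijective fun x => ?_
  have he : e x = QuotientGroup.mk (φ x.out) := by
    conv_lhs => rw [← QuotientGroup.out_eq' x]
    rfl
  rw [he, smul_out hga, hφ, smul_smul, smul_smul]
  congr 1
  group

theorem conjFix_mem {P : Subgroup G} (g : Subgroup.normalizer (P : Set G)) :
    brauerIdeal A P ≤ (brauerIdeal A P).comap (conjFix P g) := by
  unfold brauerIdeal
  refine iSup_le fun K x hx => ?_
  obtain ⟨a, ha, hx⟩ := hx
  have hlt : K.1.map (MulAut.conj (g : G)).toMonoidHom < P := by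
    have h := (Subgroup.map_lt_map_iff_of_injective
      (f := (MulAut.conj (g : G)).toMonoidHom) (MulAut.conj (g : G)).injective).2 K.2
    exact h.trans_eq (Subgroup.mem_normalizer_iff_map_conj_eq.1 g.2)
  rw [Ideal.mem_comap]
  refine Submodule.mem_iSup_of_mem ⟨_, hlt⟩ ⟨(g : G) • a, ?_, ?_⟩
  · rw [mem_Fix]
    rintro _ ⟨k, hk, rfl⟩
    have e : (MulAut.conj (g : G)).toMonoidHom k * (g : G) = g * k := by simp
    rw [smul_smul, e, mul_smul, mem_Fix.1 ha k hk]
  · rw [coe_conjFix, hx, smul_relTrace_conj g.2 ha]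

/-- The action of `N_G(P)` on `A(P)` by ring automorphisms, `g • Br_P(a) = Br_P(g • a)`. -/
noncomputable instance brauerAction (P : Subgroup G) :
    MulSemiringAction (Subgroup.normalizer (P : Set G)) (BrauerQuotient A P) where
  smul g z := Ideal.quotientMap (brauerIdeal A P) (conjFix P g) (conjFix_mem g) z
  one_smul z := by
    obtain ⟨x, rfl⟩ := Ideal.Quotient.mk_surjective z
    change Ideal.Quotient.mk _ (conjFix P 1 x) = Ideal.Quotient.mk _ x
    congr 1
    exact Subtype.ext (by rw [coe_conjFix, Subgroup.coe_one, one_smul])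
  mul_smul g h z := by
    obtain ⟨x, rfl⟩ := Ideal.Quotient.mk_surjective z
    change Ideal.Quotient.mk _ (conjFix P (g * h) x) =
      Ideal.Quotient.mk _ (conjFix P g (conjFix P h x))
    congr 1
    exact Subtype.ext (by simp only [coe_conjFix, Subgroup.coe_mul, mul_smul])
  smul_zero g := map_zero (Ideal.quotientMap (brauerIdeal A P) (conjFix P g) (conjFix_mem g))
  smul_add g := map_add (Ideal.quotientMap (brauerIdeal A P) (conjFix P g) (conjFix_mem g))
  smul_one g := map_one (Ideal.quotientMap (brauerIdeal A P) (conjFix P g) (conjFix_mem g))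
  smul_mul g := map_mul (Ideal.quotientMap (brauerIdeal A P) (conjFix P g) (conjFix_mem g))

/-- `f` is a primitive idempotent of `A(Q)^{C_N(Q)}`. -/
def IsPrimitiveInCentralizerFixed (N Q : Subgroup G) (f : BrauerQuotient A Q) : Prop :=
  ∃ h : f ∈ FixedPoints.subring (BrauerQuotient A Q)
      ((Subgroup.centralizer (Q : Set G) ⊓ N).subgroupOf (Subgroup.normalizer (Q : Set G))),
    IsPrimitiveIdem (⟨f, h⟩ : FixedPoints.subring (BrauerQuotient A Q)
      ((Subgroup.centralizer (Q : Set G) ⊓ N).subgroupOf (Subgroup.normalizer (Q : Set G))))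

/-! ### Defect groups, Brauer pairs -/

/-- `P` is a defect group of the set `α ⊆ A^H` (meant for a point): `P` is a minimal subgroup
of `H` with `α ⊆ A_P^H`. -/
def IsDefectGroup {H : Subgroup G} (α : Set (Fix A H)) (P : Subgroup G) : Prop :=
  Minimal (fun K : Subgroup G => ∃ h : K ≤ H, ∀ i ∈ α, i ∈ traceIdeal A h) P

/-- `(P, f)` is an `(A, c, G)`-Brauer pair: `P` is a `p`-subgroup of `G` and `f` is a block of
`A(P)` with `Br_P(c) f ≠ 0`. -/
def IsBrauerPair (p : ℕ) (c : Fix A (⊤ : Subgroup G)) (P : Subgroup G)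
    (f : BrauerQuotient A P) : Prop :=
  IsPGroup p P ∧ IsBlock f ∧ Br P (res le_top c) * f ≠ 0

/-- The inclusion `(Q, e) ≤ (P, f)` of Brauer pairs: `Q ≤ P`, and every primitive idempotent `i`
of `A^P` with `Br_P(i) f ≠ 0` satisfies `Br_Q(i) e ≠ 0`. -/
def BrauerLE {Q P : Subgroup G} (e : BrauerQuotient A Q) (f : BrauerQuotient A P) : Prop :=
  ∃ h : Q ≤ P, ∀ i : Fix A P, IsPrimitiveIdem i → Br P i * f ≠ 0 → Br Q (res h i) * e ≠ 0

/-- The set `F₁` of the `(A, c, G)`-Brauer pairs `(R, f_R)` with `(Q, f_Q) ≤ (R, f_R)`. -/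
def F₁ (p : ℕ) (c : Fix A (⊤ : Subgroup G)) {Q : Subgroup G} (fQ : BrauerQuotient A Q) :
    Set (Σ R : Subgroup G, BrauerQuotient A R) :=
  {x | IsBrauerPair p c x.1 x.2 ∧ BrauerLE fQ x.2}

end GAlgebra

/-- A `p`-permutation `G`-algebra over `k`: for every `p`-subgroup `P` of `G` it has a finite
`k`-basis that is permuted by `P`. -/
def IsPPermutation (p : ℕ) (k G A : Type*) [Field k] [Group G] [Ring A] [Algebra k A]
    [MulSemiringAction G A] : Prop :=
  ∀ P : Subgroup G, IsPGroup p P →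
    ∃ (n : ℕ) (b : Module.Basis (Fin n) k A), ∀ x ∈ P, ∀ s : Fin n, ∃ t : Fin n, x • b s = b t

/-- An `N`-interior structure on a `G`-algebra `C`: a `G`-equivariant group homomorphism
`N → Cˣ` such that `N` acts on `C` by conjugation with its image. -/
structure NInterior {G : Type*} [Group G] (N : Subgroup G) [N.Normal] (C : Type*) [Ring C]
    [MulSemiringAction G C] where
  toUnits : N →* Cˣ
  smul_toUnits : ∀ (g : G) (n : N),
    g • (toUnits n : C) = toUnits ⟨g * n * g⁻¹, Subgroup.Normal.conj_mem ‹N.Normal› n n.2 g⟩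
  smul_eq : ∀ (n : N) (x : C), (n : G) • x = toUnits n * x * ((toUnits n)⁻¹ : Cˣ)

section Covering

variable {k G A C : Type*} [Field k] [Group G] [Finite G] [Ring A] [Algebra k A]
  [MulSemiringAction G A] [Ring C] [Algebra k C] [MulSemiringAction G C]

/-- The point `α` of `A^G` covers `c` (an element of the subalgebra `ι(C)` of `A`, of defect group
`Q` in `N`): there are `i ∈ α` and a point `ε` of `A^N` with defect group `Q` such that
`ic = ci = i`, `if = fi = f` and `cf₁ = f₁c = f₁` for some `f, f₁ ∈ ε`. -/
def Covers (ι : C →ₙₐ[k] A) (N : Subgroup G) (c : C) (Q : Subgroup G)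
    (α : Set (Fix A (⊤ : Subgroup G))) : Prop :=
  ∃ i ∈ α, ∃ ε : Set (Fix A N), IsPoint ε ∧ IsDefectGroup ε Q ∧
    (ι c * i = (i : A) ∧ (i : A) * ι c = i) ∧
    (∃ f ∈ ε, (i : A) * f = f ∧ (f : A) * i = f) ∧
    (∃ f₁ ∈ ε, ι c * f₁ = (f₁ : A) ∧ (f₁ : A) * ι c = f₁)

end Covering

end PermAlg

/-! Take `i ∈ α` and `f ∈ ε` with `i f = f`. The Brauer map at a defect group of a primitive
idempotent does not kill it, so `Br_Q(f) ≠ 0` and hence `Br_Q(i) ≠ 0`. By a Mackey argument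
(`exists_le_conj_of_not_mem_brKer`) some defect group `P` of `i` then contains `Q`. Since `c i = i`
and `Br_P(i) ≠ 0`, also `Br_R(c) ≠ 0` for all `R ≤ P`. As `c` is a trace from `Q` to `N`, the case
`R = P ⊓ N` puts `P ⊓ N` inside an `N`-conjugate of `Q`. Orders force `P ⊓ N = Q`, and therefore `P`
normalizes `Q`.

It remains to find the block at `P`. The group `P` permutes the blocks of `C(Q)`, and orbits without
fixed points contribute only proper traces. So `Br_P(c) ≠ 0` is detected by a `P`-stable block `e`
(`IsPPermutation.exists_stable_block`), which lies below some block of `C(P)`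
(`IsPPermutation.exists_brauerLE`). The blocks of `C(Q)` not killed by `Br_Q(c)` are
`N_N(Q)`-conjugate (`exists_smul_eq_of_block`), because `c C^N c` is local. Conjugating `P` by an
element of `N_N(Q)` thus replaces `e` by `fQ`.

The `p`-permutation hypothesis enters through stable bases: the kernel of `Br_P` is read off from
the coefficients at `P`-fixed basis elements, so on `A^P` the map `Br_P` factors through `Br_Q` for
`Q ≤ P`. -/

open scoped Pointwise

namespace PermAlg

/-! ### Relative traces, Mackey-type arguments and the kernel of the Brauer map -/

section Trace

variable {G : Type*} [Group G] {A : Type*} [Ring A] [MulSemiringAction G A]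

theorem smul_mem_Fix_conj {P : Subgroup G} {a : A} (g : G) (ha : a ∈ Fix A P) :
    g • a ∈ Fix A (MulAut.conj g • P) := by
  rw [mem_Fix]
  intro h hh
  rw [Subgroup.mem_pointwise_smul_iff_inv_smul_mem] at hh
  have := mem_Fix.1 ha _ hh
  rw [← inv_smul_eq_iff, smul_smul, smul_smul]
  simpa [MulAut.smul_def] using this

variable [Finite G]

/-- The fibres of `φ` are the cosets of `K ⊓ H`, so `T` is another model of `H/K`. This recognizes
traces without handling chosen representatives. -/
theorem sum_eq_relTrace {K H : Subgroup G} {X : Type*} (T : Finset X) (φ : H → X)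
    (hT : ∀ x, x ∈ T ↔ ∃ h, φ h = x)
    (hφ : ∀ h h' : H, φ h = φ h' ↔ (h : G)⁻¹ * h' ∈ K) (F : X → A) (a : A)
    (hF : ∀ h : H, F (φ h) = (h : G) • a) : ∑ x ∈ T, F x = relTrace K H a := by
  have := Fintype.ofFinite (H ⧸ K.subgroupOf H)
  have key : ∀ h : H, φ (QuotientGroup.mk h : H ⧸ K.subgroupOf H).out = φ h := by
    intro h
    rw [hφ]
    have := QuotientGroup.eq.1 (QuotientGroup.out_eq' (QuotientGroup.mk h : H ⧸ K.subgroupOf H))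
    simpa [Subgroup.mem_subgroupOf] using this
  rw [relTrace, finsum_eq_sum_of_fintype]
  symm
  refine Finset.sum_bij (fun q _ => φ q.out) (fun q _ => (hT _).2 ⟨_, rfl⟩) ?_ ?_ ?_
  · intro q _ q' _ h
    rw [hφ] at h
    rw [← QuotientGroup.out_eq' q, ← QuotientGroup.out_eq' q', QuotientGroup.eq]
    simpa [Subgroup.mem_subgroupOf] using h
  · intro x hx
    obtain ⟨h, rfl⟩ := (hT x).1 hx
    exact ⟨QuotientGroup.mk h, Finset.mem_univ _, key h⟩
  · intro q _
    exact (hF _).symm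

/-- The sum splits over the `R`-orbits, and the orbit of `x` contributes the trace of `F x` from the
stabilizer of `x`. -/
theorem sum_mem_of_relTrace_mem {R : Subgroup G} {X : Type*} [Fintype X] [MulAction R X]
    (F : X → A) (hF : ∀ (r : R) (x : X), F (r • x) = (r : G) • F x) (S : AddSubgroup A)
    (h : ∀ x, relTrace ((MulAction.stabilizer R x).map R.subtype) R (F x) ∈ S) :
    ∑ x, F x ∈ S := by
  classical
  rw [← Finset.sum_fiberwise (g := fun x => (Quotient.mk (MulAction.orbitRel R X) x))]
  refine sum_mem fun ω _ => ?_
  rw [sum_eq_relTrace (K := (MulAction.stabilizer R ω.out).map R.subtype) (H := R) _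
    (fun r => r • ω.out) ?_ ?_ F (F ω.out) (fun r => hF r _)]
  · exact h _
  · intro x
    simp only [Finset.mem_filter, Finset.mem_univ, true_and]
    rw [← Quotient.out_eq ω, Quotient.eq, MulAction.orbitRel_apply, Quotient.out_eq]
    rfl
  · intro r r'
    rw [Subgroup.mem_map]
    constructor
    · intro e
      refine ⟨r⁻¹ * r', ?_, rfl⟩
      rw [MulAction.mem_stabilizer_iff, mul_smul, ← e, inv_smul_smul]
    · rintro ⟨s, hs, e⟩
      have : s = r⁻¹ * r' := Subtype.ext e
      rw [this, MulAction.mem_stabilizer_iff, mul_smul, inv_smul_eq_iff] at hs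
      exact hs.symm

theorem relTrace_relTrace {K P H : Subgroup G} (hKP : K ≤ P) (hPH : P ≤ H) {a : A}
    (ha : a ∈ Fix A K) : relTrace P H (relTrace K P a) = relTrace K H a := by
  have := Fintype.ofFinite (H ⧸ P.subgroupOf H)
  have := Fintype.ofFinite (P ⧸ K.subgroupOf P)
  have hmem : ∀ h : H, ((((QuotientGroup.mk h : H ⧸ P.subgroupOf H).out : H) : G))⁻¹ * h ∈ P := by
    intro h
    have := QuotientGroup.eq.1 (QuotientGroup.out_eq' (QuotientGroup.mk h : H ⧸ P.subgroupOf H))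
    simpa [Subgroup.mem_subgroupOf] using this
  have e : relTrace P H (relTrace K P a) =
      ∑ q ∈ (Finset.univ : Finset ((H ⧸ P.subgroupOf H) × (P ⧸ K.subgroupOf P))),
        ((q.1.out : H) : G) • ((q.2.out : P) : G) • a := by
    rw [← Finset.univ_product_univ, Finset.sum_product, relTrace, finsum_eq_sum_of_fintype]
    refine Finset.sum_congr rfl fun q _ => ?_
    rw [relTrace, finsum_eq_sum_of_fintype, Finset.smul_sum]
  rw [e]
  refine sum_eq_relTrace _ (fun h : H => (QuotientGroup.mk h, QuotientGroup.mk ⟨_, hmem h⟩)) ?_ ?_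
    (fun q => ((q.1.out : H) : G) • ((q.2.out : P) : G) • a) a ?_
  · rintro ⟨x, y⟩
    simp only [Finset.mem_univ, true_iff]
    refine ⟨x.out * ⟨y.out, hPH y.out.2⟩, ?_⟩
    have h1 : (QuotientGroup.mk (x.out * ⟨y.out, hPH y.out.2⟩) : H ⧸ P.subgroupOf H) = x := by
      conv_rhs => rw [← QuotientGroup.out_eq' x]
      rw [eq_comm, QuotientGroup.eq]
      simp [Subgroup.mem_subgroupOf]
    refine Prod.ext h1 ?_
    conv_rhs => rw [← QuotientGroup.out_eq' y]
    simp only [h1]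
    congr 1
    ext
    simp
  · intro h h'
    simp only [Prod.mk.injEq, QuotientGroup.eq, Subgroup.mem_subgroupOf]
    constructor
    · rintro ⟨h1, h2⟩
      have : (QuotientGroup.mk h : H ⧸ P.subgroupOf H) = QuotientGroup.mk h' := by
        rw [QuotientGroup.eq]; exact h1
      simpa [this, mul_assoc] using h2
    · intro h1
      have h2 : (QuotientGroup.mk h : H ⧸ P.subgroupOf H) = QuotientGroup.mk h' := by
        rw [QuotientGroup.eq]; exact hKP h1
      refine ⟨hKP h1, ?_⟩
      simpa [h2, mul_assoc] using h1
  · intro h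
    simp only
    rw [smul_out ha, smul_smul]
    simp

theorem relTrace_conj (g : G) {K H : Subgroup G} {a : A} (ha : a ∈ Fix A K) :
    g • relTrace K H a = relTrace (MulAut.conj g • K) (MulAut.conj g • H) (g • a) := by
  have := Fintype.ofFinite (H ⧸ K.subgroupOf H)
  rw [smul_relTrace, finsum_eq_sum_of_fintype]
  have hm : ∀ h : (MulAut.conj g • H : Subgroup G), g⁻¹ * h * g ∈ H := by
    intro h
    have := h.2
    rw [Subgroup.mem_pointwise_smul_iff_inv_smul_mem] at this
    simpa [MulAut.smul_def] using this
  refine sum_eq_relTrace _ (fun h => QuotientGroup.mk (⟨_, hm h⟩ : H)) ?_ ?_ _ _ ?_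
  · intro q
    simp only [Finset.mem_univ, true_iff]
    refine ⟨⟨g * q.out * g⁻¹, ?_⟩, ?_⟩
    · rw [Subgroup.mem_pointwise_smul_iff_inv_smul_mem]
      simp [MulAut.smul_def, mul_assoc]
    · conv_rhs => rw [← QuotientGroup.out_eq' q]
      congr 1
      ext
      simp [mul_assoc]
  · intro h h'
    rw [QuotientGroup.eq, Subgroup.mem_pointwise_smul_iff_inv_smul_mem, Subgroup.mem_subgroupOf]
    simp [MulAut.smul_def, mul_assoc]
  · intro h
    rw [smul_out ha, smul_smul, smul_smul]
    congr 1
    simp [mul_assoc]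

theorem relTrace_self {H : Subgroup G} {a : A} (ha : a ∈ Fix A H) : relTrace H H a = a := by
  have h := sum_eq_relTrace (K := H) (H := H) (A := A) (X := Unit) Finset.univ (fun _ => ())
    (by simp) (by intro h h'; simpa using H.mul_mem (H.inv_mem h.2) h'.2) (fun _ => a) a
    (fun h => (mem_Fix.1 ha h h.2).symm)
  simpa using h.symm

theorem relTrace_of_mem_Fix {K H : Subgroup G} {a : A} (ha : a ∈ Fix A H) :
    relTrace K H a = (K.subgroupOf H).index • a := by
  have := Fintype.ofFinite (H ⧸ K.subgroupOf H)
  rw [relTrace, finsum_eq_sum_of_fintype, Finset.sum_congr rfl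
    (fun x _ => mem_Fix.1 ha _ x.out.2), Finset.sum_const, Finset.card_univ,
    ← Nat.card_eq_fintype_card]
  rfl

/-- The kernel of the Brauer map, as a subgroup of the algebra. -/
def brKer (A : Type*) [Ring A] [MulSemiringAction G A] (P : Subgroup G) : AddSubgroup A :=
  (brauerIdeal A P).toAddSubgroup.map (Fix A P).subtype.toAddMonoidHom

theorem coe_mem_brKer {P : Subgroup G} {z : Fix A P} :
    (z : A) ∈ brKer A P ↔ z ∈ brauerIdeal A P := by
  constructor
  · rintro ⟨y, hy, e⟩
    exact (Subtype.ext e : y = z) ▸ hy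
  · exact fun h => ⟨z, h, rfl⟩

theorem Br_eq_zero {P : Subgroup G} {z : Fix A P} : Br P z = 0 ↔ (z : A) ∈ brKer A P := by
  rw [coe_mem_brKer, Br, Ideal.Quotient.eq_zero_iff_mem]

theorem Br_eq {P : Subgroup G} {z y : Fix A P} : Br P z = Br P y ↔ (z - y : A) ∈ brKer A P := by
  rw [← sub_eq_zero, ← map_sub, Br_eq_zero]; rfl

theorem Br_surjective (P : Subgroup G) : Function.Surjective (Br P : Fix A P →+* _) :=
  Ideal.Quotient.mk_surjective

theorem relTrace_mem_brKer {K P : Subgroup G} (h : K < P) {a : A} (ha : a ∈ Fix A K) :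
    relTrace K P a ∈ brKer A P := by
  change ((⟨_, relTrace_mem ha⟩ : Fix A P) : A) ∈ _
  rw [coe_mem_brKer]
  exact Submodule.mem_iSup_of_mem ⟨K, h⟩ ⟨a, ha, rfl⟩

theorem brKer_le {P : Subgroup G} {S : AddSubgroup A}
    (h : ∀ K < P, ∀ a ∈ Fix A K, relTrace K P a ∈ S) : brKer A P ≤ S := by
  rintro _ ⟨z, hz, rfl⟩
  change z ∈ brauerIdeal A P at hz
  unfold brauerIdeal at hz
  change (z : A) ∈ S
  induction hz using Submodule.iSup_induction' with
  | mem K x hx =>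
    obtain ⟨a, ha, e⟩ := hx
    exact e ▸ h K.1 K.2 a ha
  | zero => exact zero_mem S
  | add x y _ _ hx hy => exact add_mem hx hy

theorem mul_mem_brKer_right {P : Subgroup G} {x z : A} (hx : x ∈ Fix A P) (hz : z ∈ brKer A P) :
    z * x ∈ brKer A P := by
  obtain ⟨y, hy, rfl⟩ := hz
  exact ⟨y * ⟨x, hx⟩, (brauerIdeal A P).mul_mem_right _ hy, rfl⟩

theorem smul_mem_brKer {P : Subgroup G} (g : G) {z : A} (hz : z ∈ brKer A P) :
    g • z ∈ brKer A (MulAut.conj g • P) := by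
  have : brKer A P ≤ (brKer A (MulAut.conj g • P)).comap (DistribSMul.toAddMonoidHom A g) := by
    refine brKer_le fun K hK a ha => ?_
    rw [AddSubgroup.mem_comap, DistribSMul.toAddMonoidHom_apply, relTrace_conj g ha]
    refine relTrace_mem_brKer ?_ (smul_mem_Fix_conj g ha)
    exact lt_of_le_not_ge (Subgroup.pointwise_smul_le_pointwise_smul_iff.2 hK.le)
      fun h => hK.not_ge (Subgroup.pointwise_smul_le_pointwise_smul_iff.1 h)
  exact this hz

theorem smul_mem_brKer_iff {P : Subgroup G} (g : G) {z : A} :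
    g • z ∈ brKer A (MulAut.conj g • P) ↔ z ∈ brKer A P := by
  refine ⟨fun h => ?_, smul_mem_brKer g⟩
  have := smul_mem_brKer g⁻¹ h
  rwa [inv_smul_smul, map_inv, inv_smul_smul] at this

/-- A sum over a finite `P`-set lies in the kernel of the Brauer map if its terms at the fixed
points do. -/
theorem sum_mem_brKer {P : Subgroup G} {X : Type*} [Fintype X] [MulAction P X]
    (F : X → A) (hF : ∀ (r : P) (x : X), F (r • x) = (r : G) • F x)
    (h : ∀ x, (∀ r : P, r • x = x) → F x ∈ brKer A P) : ∑ x, F x ∈ brKer A P := by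
  refine sum_mem_of_relTrace_mem F hF _ fun x => ?_
  have hle : (MulAction.stabilizer P x).map P.subtype ≤ P := Subgroup.map_subtype_le _
  have hfix : F x ∈ Fix A ((MulAction.stabilizer P x).map P.subtype) := by
    rw [mem_Fix]
    rintro _ ⟨r, hr, rfl⟩
    exact (hF r x).symm.trans (congrArg F hr)
  rcases hle.eq_or_lt with e | e
  · rw [e] at hfix ⊢
    rw [relTrace_self hfix]
    refine h x fun r => ?_
    obtain ⟨s, hs, hsr⟩ := e.ge r.2
    rw [← (Subtype.ext hsr : s = r)]
    exact hs
  · exact relTrace_mem_brKer e hfix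

/-- Mackey: `R` permutes the cosets of `K` in `H`, and the coset of `y` is fixed exactly when `R`
lies in the conjugate of `K` by `y`. Without fixed cosets all contributions are proper traces. -/
theorem exists_le_conj_of_not_mem_brKer {K H R : Subgroup G} (hRH : R ≤ H) {a : A}
    (ha : a ∈ Fix A K) (h : relTrace K H a ∉ brKer A R) :
    ∃ g ∈ H, R ≤ MulAut.conj g • K := by
  by_contra! hcon
  apply h
  have := Fintype.ofFinite (H ⧸ K.subgroupOf H)
  let _ : MulAction R (H ⧸ K.subgroupOf H) := MulAction.compHom _ (Subgroup.inclusion hRH)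
  have hs : ∀ (r : R) (y : H), r • (QuotientGroup.mk y : H ⧸ K.subgroupOf H) =
      QuotientGroup.mk (Subgroup.inclusion hRH r * y) := fun _ _ => rfl
  rw [relTrace, finsum_eq_sum_of_fintype]
  refine sum_mem_brKer (fun x : H ⧸ K.subgroupOf H => ((x.out : H) : G) • a) ?_ ?_
  · intro r x
    obtain ⟨y, rfl⟩ := QuotientGroup.mk_surjective x
    rw [hs]
    rw [smul_out ha, smul_out ha, smul_smul]
    rfl
  · intro x hx
    exfalso
    obtain ⟨y, rfl⟩ := QuotientGroup.mk_surjective x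
    refine hcon y y.2 fun r hr => ?_
    have := hx ⟨r, hr⟩
    rw [hs, eq_comm, QuotientGroup.eq, Subgroup.mem_subgroupOf] at this
    rw [Subgroup.mem_pointwise_smul_iff_inv_smul_mem]
    simpa [MulAut.smul_def, mul_assoc] using this

/-- If `w` and all its conjugates under `N_H(Q)` agree modulo the kernel of the Brauer map, then
`Tr_Q^H(w b)` and `w Tr_Q^H(b)` do. -/
theorem relTrace_mul_sub_mem_brKer {Q H : Subgroup G} (hQH : Q ≤ H) {w b : A} (hw : w ∈ Fix A Q)
    (hb : b ∈ Fix A Q)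
    (hwn : ∀ g ∈ H, g ∈ Subgroup.normalizer (Q : Set G) → g • w - w ∈ brKer A Q) :
    relTrace Q H (w * b) - w * relTrace Q H b ∈ brKer A Q := by
  have := Fintype.ofFinite (H ⧸ Q.subgroupOf H)
  let _ : MulAction Q (H ⧸ Q.subgroupOf H) := MulAction.compHom _ (Subgroup.inclusion hQH)
  have hs : ∀ (r : Q) (y : H), r • (QuotientGroup.mk y : H ⧸ Q.subgroupOf H) =
      QuotientGroup.mk (Subgroup.inclusion hQH r * y) := fun _ _ => rfl
  have e : relTrace Q H (w * b) - w * relTrace Q H b = ∑ x : H ⧸ Q.subgroupOf H,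
      (((x.out : H) : G) • w - w) * ((x.out : H) : G) • b := by
    rw [relTrace, relTrace, finsum_eq_sum_of_fintype, finsum_eq_sum_of_fintype, Finset.mul_sum,
      ← Finset.sum_sub_distrib]
    refine Finset.sum_congr rfl fun x _ => ?_
    rw [smul_mul', sub_mul]
  rw [e]
  refine sum_mem_brKer (fun x : H ⧸ Q.subgroupOf H =>
    (((x.out : H) : G) • w - w) * ((x.out : H) : G) • b) ?_ ?_
  · intro r x
    obtain ⟨y, rfl⟩ := QuotientGroup.mk_surjective x
    rw [hs]
    rw [smul_out hw, smul_out hb, smul_out hw, smul_out hb, smul_mul', smul_sub, smul_smul,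
      smul_smul, mem_Fix.1 hw r r.2]
    rfl
  · intro x hx
    obtain ⟨y, rfl⟩ := QuotientGroup.mk_surjective x
    rw [smul_out hw, smul_out hb]
    -- A coset fixed by `Q` gives `y⁻¹ Q y ≤ Q`, an equality by orders. Hence only normalizing `y`
    -- matter.
    have hy : (y : G) ∈ Subgroup.normalizer (Q : Set G) := by
      rw [← Subgroup.inv_mem_iff, Subgroup.mem_normalizer_iff_map_conj_eq]
      refine Subgroup.eq_of_le_of_card_ge ?_ ?_
      · rintro _ ⟨r, hr, rfl⟩
        have := hx ⟨r, hr⟩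
        rw [hs, eq_comm, QuotientGroup.eq, Subgroup.mem_subgroupOf] at this
        simpa [mul_assoc] using this
      · exact (Subgroup.card_map_of_injective (MulAut.conj _).injective).ge
    exact mul_mem_brKer_right (smul_mem_Fix hy hb) (hwn y y.2 hy)

end Trace

/-! ### Primitive idempotents in finite-dimensional algebras -/

section FiniteDimensional

variable {R : Type*} [Ring R]

/-- The local ring `e R e` of a primitive idempotent `e` consists of nilpotent and invertible
elements. -/
theorem IsPrimitiveIdem.nilpotent_or_invertible (k : Type*) [Field k] [Algebra k R]
    [Module.Finite k R] {e a : R} (he : IsPrimitiveIdem e) (h1 : e * a = a) (h2 : a * e = a) :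
    (∃ n : ℕ, a ^ n = 0) ∨ ∃ v, a * v = e ∧ v * e = v := by
  open Polynomial in
  obtain ⟨hidem, -, hprim⟩ := he
  have hint : IsIntegral k a := IsIntegral.of_finite k a
  have hm : minpoly k a ≠ 0 := minpoly.ne_zero hint
  obtain ⟨q, hq, hXq⟩ := exists_eq_pow_rootMultiplicity_mul_and_not_dvd (minpoly k a) hm 0
  rw [C_0, sub_zero] at hq hXq
  set n := (minpoly k a).rootMultiplicity 0 with hn
  -- Fitting decomposition of `a`. The exponent is `n + 1`, not `n`, so that the idempotent `ε` has
  -- a factor `a` even when `n = 0` and hence lies in `e R e`.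
  have hcop : IsCoprime (X ^ (n + 1)) q :=
    IsCoprime.pow_left ((irreducible_X.coprime_iff_not_dvd).2 hXq)
  obtain ⟨u, v, huv⟩ := hcop
  have h0 : a ^ n * aeval a q = 0 := by
    have := minpoly.aeval k a
    rw [hq] at this
    simpa using this
  have h3 : aeval a u * a ^ (n + 1) + aeval a v * aeval a q = 1 := by
    have := congrArg (aeval a) huv
    simpa using this
  have hc : ∀ f g : k[X], aeval a f * aeval a g = aeval a g * aeval a f := fun f g => by
    rw [← map_mul, mul_comm, map_mul]
  have hcu : aeval a u * a = a * aeval a u := by simpa using hc u X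
  have hcv : aeval a v * a ^ n = a ^ n * aeval a v := by simpa using hc v (X ^ n)
  set ε := a * (aeval a u * a ^ n) with hε
  have hε' : ε = aeval a u * a ^ (n + 1) := by
    rw [hε, ← mul_assoc, ← hcu, mul_assoc, ← pow_succ']
  have hz : a ^ n * (1 - ε) = 0 := by
    rw [hε', ← h3, add_sub_cancel_left, ← mul_assoc, ← hcv, mul_assoc, h0, mul_zero]
  have hεε : ε * (1 - ε) = 0 := by
    rw [hε, mul_assoc, mul_assoc, hz, mul_zero, mul_zero]
  have hεid : ε * ε = ε := by
    rw [mul_sub, mul_one, sub_eq_zero] at hεε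
    exact hεε.symm
  have heε : e * ε = ε := by rw [hε, ← mul_assoc, h1]
  have hεe : ε * e = ε := by rw [hε', pow_succ, mul_assoc, mul_assoc, h2]
  rcases hprim ε (e - ε) hεid
    (by
      rw [IsIdempotentElem, sub_mul, mul_sub, mul_sub, hidem, heε, hεe, hεid, sub_self, sub_zero])
    (by rw [mul_sub, hεe, hεid, sub_self]) (by rw [sub_mul, heε, hεid, sub_self])
    (add_sub_cancel _ _) with h | h
  · left
    refine ⟨n, ?_⟩
    simpa [h] using hz
  · right
    refine ⟨aeval a u * a ^ n * e, ?_, by rw [mul_assoc, hidem]⟩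
    rw [← mul_assoc, ← hε, hεe, ← sub_eq_zero.1 h]

/-- If `e = x + y` is primitive and `x` lies in the two-sided ideal `I`, then `e ∈ I` or `e y e`
is invertible in `e R e`. -/
theorem IsPrimitiveIdem.mem_or_invertible (k : Type*) [Field k] [Algebra k R]
    [Module.Finite k R] {e x y : R} (he : IsPrimitiveIdem e) (h : x + y = e)
    (I : Ideal R) (hI : ∀ z ∈ I, ∀ r, z * r ∈ I) (hx : x ∈ I) :
    e ∈ I ∨ ∃ w, e * y * w = e := by
  have hid : e * e = e := he.1
  rcases he.nilpotent_or_invertible k (a := e * x * e) (by rw [← mul_assoc, ← mul_assoc, hid])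
    (by rw [mul_assoc, hid]) with ⟨n, hn⟩ | ⟨v, hv, -⟩
  · right
    have h1 : e * y * e = e - e * x * e := by
      rw [eq_sub_of_add_eq' h, mul_sub, sub_mul, hid, hid]
    have hu : IsUnit (1 - e * x * e) := IsNilpotent.isUnit_one_sub ⟨n, hn⟩
    obtain ⟨u, hu⟩ := hu
    refine ⟨e * (u⁻¹ : Rˣ), ?_⟩
    have h2 : e * y * e = e * u := by
      rw [h1, hu, mul_sub, mul_one, ← mul_assoc, ← mul_assoc, hid]
    rw [← mul_assoc, h2, mul_assoc, Units.mul_inv, mul_one]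
  · left
    rw [← hv]
    exact hI _ (hI _ (I.mul_mem_left _ hx) _) _

/-- Peel off one term at a time: if its ideal misses `e`, the remaining sum is invertible in `e R
e`, and multiplying by an inverse writes `e` as a shorter sum. -/
theorem IsPrimitiveIdem.exists_mem_of_sum (k : Type*) [Field k] [Algebra k R]
    [Module.Finite k R] {e : R} (he : IsPrimitiveIdem e) {κ : Type*} (I : κ → Ideal R)
    (hI : ∀ i, ∀ z ∈ I i, ∀ r, z * r ∈ I i) (s : Finset κ) (x : κ → R) (hx : ∀ i, x i ∈ I i)
    (h : ∑ i ∈ s, x i = e) : ∃ i, e ∈ I i := by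
  classical
  induction s using Finset.induction_on generalizing x with
  | empty => exact absurd h.symm he.2.1
  | insert i s hi ih =>
    rw [Finset.sum_insert hi] at h
    rcases he.mem_or_invertible k h (I i) (hI i) (hx i) with h' | ⟨w, hw⟩
    · exact ⟨i, h'⟩
    · refine ih (fun j => e * x j * w) (fun j => hI _ _ ((I j).mul_mem_left _ (hx j)) _) ?_
      rw [← Finset.sum_mul, ← Finset.mul_sum, hw]

/-- Rosenberg's lemma. -/
theorem IsPrimitiveIdem.exists_mem_of_iSup (k : Type*) [Field k] [Algebra k R]
    [Module.Finite k R] {e : R} (he : IsPrimitiveIdem e) {κ : Type*} (I : κ → Ideal R)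
    (hI : ∀ i, ∀ z ∈ I i, ∀ r, z * r ∈ I i) (h : e ∈ ⨆ i, I i) : ∃ i, e ∈ I i := by
  classical
  rw [Submodule.mem_iSup_iff_exists_dfinsupp'] at h
  obtain ⟨f, hf⟩ := h
  exact he.exists_mem_of_sum k I hI f.support (fun i => f i) (fun i => (f i).2) hf

/-! ### Primitive idempotents of commutative rings, and blocks -/

theorem IsPrimitiveIdem.eq_of_mul_ne_zero {R : Type*} [CommRing R] {e f : R}
    (he : IsPrimitiveIdem e) (hf : IsPrimitiveIdem f) (h : e * f ≠ 0) : e = f := by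
  have key : ∀ {e f : R}, IsPrimitiveIdem e → IsPrimitiveIdem f → e * f ≠ 0 → e * f = e := by
    intro e f he hf h
    have he' : e * e = e := he.1
    have hf' : f * f = f := hf.1
    have h1 : e * f * (e * f) = e * f := by rw [mul_mul_mul_comm, he', hf']
    rcases he.2.2 (e * f) (e - e * f) h1
      (by rw [IsIdempotentElem]; linear_combination he' + h1 - 2 * f * he')
      (by linear_combination f * he' - h1) (by linear_combination f * he' - h1)
      (add_sub_cancel _ _) with h' | h'
    · exact absurd h' h
    · exact (sub_eq_zero.1 h').symm
  rw [← key he hf h, mul_comm e f]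
  exact key hf he (by rwa [mul_comm])

/-- Descent: an idempotent outside the span that generates a minimal ideal must be primitive, since
in a proper splitting both parts generate smaller ideals and so lie in the span. -/
theorem one_mem_span_primitive {R : Type*} [CommRing R] [IsArtinianRing R] :
    (1 : R) ∈ Ideal.span {e : R | IsPrimitiveIdem e} := by
  by_contra hcon
  obtain ⟨I, ⟨e, he, heJ, rfl⟩, hmin⟩ := IsArtinian.set_has_minimal (R := R) (M := R)
    {I | ∃ e : R, IsIdempotentElem e ∧ e ∉ Ideal.span {e : R | IsPrimitiveIdem e} ∧
      I = Ideal.span {e}} ⟨_, 1, IsIdempotentElem.one, hcon, rfl⟩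
  apply heJ
  refine Ideal.subset_span ⟨he, ?_, ?_⟩
  · rintro rfl
    exact heJ (zero_mem _)
  · have key : ∀ x y : R, IsIdempotentElem x → x * y = 0 → x + y = e → y ≠ 0 →
        x ∈ Ideal.span {e : R | IsPrimitiveIdem e} := by
      intro x y hx hxy hs hy
      by_contra hxJ
      have hx' : x * x = x := hx
      refine hmin _ ⟨x, hx, hxJ, rfl⟩ (lt_of_le_of_ne ?_ ?_)
      · rw [Ideal.span_singleton_le_span_singleton]
        exact ⟨x, by rw [← hs]; linear_combination -hx' - hxy⟩
      · intro h
        have : e ∈ Ideal.span {x} := h ▸ Ideal.mem_span_singleton_self e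
        obtain ⟨r, hr⟩ := Ideal.mem_span_singleton.1 this
        have he' : e * e = e := he
        apply hy
        have h3 : y * e = 0 := by rw [hr]; linear_combination r * hxy
        have h4 : x * e = x := by rw [← hs]; linear_combination hx' + hxy
        have h5 : e = x := by
          have : e * e = x * e + y * e := by rw [← hs]; ring
          rw [he', h3, h4, add_zero] at this
          exact this
        rw [h5] at hs
        exact add_eq_left.1 hs
    intro x y hx hy hxy hyx hs
    by_contra! hne
    apply heJ
    rw [← hs]
    exact add_mem (key x y hx hxy hs hne.2) (key y x hy hyx (by rw [add_comm, hs]) hne.1)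

/-- Finitely many primitive idempotents already generate `1`; any other one would be orthogonal to
all of them and so annihilate `1`. -/
theorem finite_primitive {R : Type*} [CommRing R] [IsArtinianRing R] :
    {e : R | IsPrimitiveIdem e}.Finite := by
  obtain ⟨s, hs, h1⟩ := Submodule.mem_span_finite_of_mem_span (one_mem_span_primitive (R := R))
  refine s.finite_toSet.subset fun e he => ?_
  by_contra hes
  have : ∀ x ∈ Ideal.span (s : Set R), e * x = 0 := by
    intro x hx
    induction hx using Submodule.span_induction with
    | mem x hx =>
      by_contra h
      exact hes (he.eq_of_mul_ne_zero (hs hx) h ▸ hx)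
    | zero => exact mul_zero e
    | add x y _ _ hx hy => rw [mul_add, hx, hy, add_zero]
    | smul r x _ hx => rw [smul_eq_mul, mul_left_comm, hx, mul_zero]
  exact he.2.1 (by simpa using this 1 h1)

theorem sum_primitive {R : Type*} [CommRing R] (S : Finset R)
    (hS : ∀ e, e ∈ S ↔ IsPrimitiveIdem e) [IsArtinianRing R] : ∑ e ∈ S, e = 1 := by
  have : ∀ x ∈ Ideal.span {e : R | IsPrimitiveIdem e}, x * ∑ e ∈ S, e = x := by
    intro x hx
    induction hx using Submodule.span_induction with
    | mem x hx =>
      rw [Finset.mul_sum, Finset.sum_eq_single x]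
      · exact hx.1
      · intro b hb hbx
        by_contra h
        exact hbx (IsPrimitiveIdem.eq_of_mul_ne_zero hx ((hS b).1 hb) h).symm
      · exact fun h => absurd ((hS x).2 hx) h
    | zero => exact zero_mul _
    | add x y _ _ hx hy => rw [add_mul, hx, hy]
    | smul r x _ hx => rw [smul_eq_mul, mul_assoc, hx]
  simpa using this 1 one_mem_span_primitive

theorem IsBlock.commute {R : Type*} [Ring R] {e : R} (he : IsBlock e) (x : R) :
    e * x = x * e := (Subring.mem_center_iff.1 he.1 x).symm

theorem IsBlock.idem {R : Type*} [Ring R] {e : R} (he : IsBlock e) : e * e = e :=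
  congrArg Subtype.val he.2.1

theorem IsBlock.ne_zero {R : Type*} [Ring R] {e : R} (he : IsBlock e) : e ≠ 0 :=
  fun h => he.2.2.1 (Subtype.ext h)

theorem IsBlock.eq_of_mul_ne_zero {R : Type*} [Ring R] {e f : R} (he : IsBlock e)
    (hf : IsBlock f) (h : e * f ≠ 0) : e = f :=
  congrArg Subtype.val (he.2.eq_of_mul_ne_zero hf.2 fun h' => h (congrArg Subtype.val h'))

theorem IsBlock.mul_eq_of_central {R : Type*} [Ring R] {e z : R} (he : IsBlock e)
    (hz : z ∈ Subring.center R) (hzz : z * z = z) (h : z * e ≠ 0) : z * e = e := by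
  obtain ⟨hc, hp⟩ := he
  rcases hp.2.2 (⟨z, hz⟩ * ⟨e, hc⟩) ((1 - ⟨z, hz⟩) * ⟨e, hc⟩)
    (IsIdempotentElem.mul (Subtype.ext hzz) hp.1)
    (IsIdempotentElem.mul (IsIdempotentElem.one_sub (Subtype.ext hzz)) hp.1)
    (by
      have h1 : (⟨z, hz⟩ : Subring.center R) * ⟨z, hz⟩ = ⟨z, hz⟩ := Subtype.ext hzz
      linear_combination (-(⟨e, hc⟩ : Subring.center R) * ⟨e, hc⟩) * h1)
    (by
      have h1 : (⟨z, hz⟩ : Subring.center R) * ⟨z, hz⟩ = ⟨z, hz⟩ := Subtype.ext hzz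
      linear_combination (-(⟨e, hc⟩ : Subring.center R) * ⟨e, hc⟩) * h1)
    (by ring) with h' | h'
  · exact absurd (congrArg Subtype.val h') h
  · rw [sub_mul, one_mul, sub_eq_zero] at h'
    exact (congrArg Subtype.val h').symm

theorem IsPrimitiveIdem.map {R R' : Type*} [Ring R] [Ring R'] (f : R ≃+* R') {e : R}
    (he : IsPrimitiveIdem e) : IsPrimitiveIdem (f e) := by
  obtain ⟨hi, h0, hp⟩ := he
  refine ⟨hi.map f, (map_ne_zero_iff f f.injective).2 h0, fun x y hx hy hxy hyx hs => ?_⟩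
  have h := hp (f.symm x) (f.symm y) (hx.map f.symm) (hy.map f.symm)
    (by rw [← map_mul, hxy, map_zero]) (by rw [← map_mul, hyx, map_zero])
    (by rw [← map_add, hs, f.symm_apply_apply])
  rwa [map_eq_zero_iff _ f.symm.injective, map_eq_zero_iff _ f.symm.injective] at h

theorem IsBlock.map {R R' : Type*} [Ring R] [Ring R'] (f : R ≃+* R') {e : R} (he : IsBlock e) :
    IsBlock (f e) := by
  obtain ⟨hc, hp⟩ := he
  exact ⟨_, hp.map (Subring.centerCongr f)⟩

/-- The blocks of a finite-dimensional algebra are finite in number, with sum `1`. -/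
theorem exists_blocks (k R : Type*) [Field k] [Ring R] [Algebra k R] [Module.Finite k R] :
    ∃ S : Finset R, (∀ e, e ∈ S ↔ IsBlock e) ∧ ∑ e ∈ S, e = 1 := by
  classical
  have hfin : Module.Finite k (Subalgebra.center k R) :=
    Module.Finite.of_injective (Subalgebra.center k R).val.toLinearMap Subtype.val_injective
  have hart : IsArtinianRing (Subring.center R) :=
    IsArtinianRing.of_finite k (Subalgebra.center k R)
  have hS := fun e => (finite_primitive (R := Subring.center R)).mem_toFinset (a := e)
  have h1 := sum_primitive _ hS
  refine ⟨(finite_primitive (R := Subring.center R)).toFinset.map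
    ⟨Subtype.val, Subtype.val_injective⟩, fun e => ?_, ?_⟩
  · rw [Finset.mem_map]
    constructor
    · rintro ⟨x, hx, rfl⟩
      exact ⟨x.2, (hS x).1 hx⟩
    · rintro ⟨hc, h⟩
      exact ⟨⟨e, hc⟩, (hS _).2 h, rfl⟩
  · rw [Finset.sum_map]
    have := congrArg (Subring.center R).subtype h1
    rw [map_sum, map_one] at this
    exact this

end FiniteDimensional

/-! ### Stable bases and the Brauer map of a `p`-permutation algebra -/

section Basis

variable {p : ℕ} {k : Type*} [Field k] {G : Type*} [Group G]
  {A : Type*} [Ring A] [Algebra k A] [MulSemiringAction G A]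

theorem IsPPermutation.finite (hA : IsPPermutation p k G A) : Module.Finite k A := by
  obtain ⟨n, b, -⟩ := hA ⊥ IsPGroup.of_bot
  exact Module.Finite.of_basis b

theorem IsPPermutation.exists_stable_basis (hA : IsPPermutation p k G A) {P : Subgroup G}
    (hP : IsPGroup p P) : ∃ (X : Set A) (_ : Finite X) (b : Module.Basis X k A),
      (∀ x, b x = x) ∧ ∀ g ∈ P, ∀ x ∈ X, g • x ∈ X := by
  obtain ⟨n, b, h⟩ := hA P hP
  refine ⟨Set.range b, inferInstance, b.reindexRange, fun x => b.reindexRange_apply x, ?_⟩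
  rintro g hg _ ⟨s, rfl⟩
  obtain ⟨t, ht⟩ := h g hg s
  exact ⟨t, ht.symm⟩

/-- The action of `P` on a `P`-stable subset. -/
abbrev stableAction {P : Subgroup G} {X : Set A} (hX : ∀ g ∈ P, ∀ x ∈ X, g • x ∈ X) :
    MulAction P X where
  smul g x := ⟨(g : G) • (x : A), hX g g.2 x x.2⟩
  one_smul x := Subtype.ext (one_smul G (x : A))
  mul_smul g h x := Subtype.ext (mul_smul (g : G) (h : G) (x : A))

variable [SMulCommClass G k A]

theorem repr_smul_smul {X : Set A} (b : Module.Basis X k A) (hb : ∀ x, b x = x) {g : G}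
    (hX : ∀ x ∈ X, g • x ∈ X) (z : A) (x : X) :
    b.repr (g • z) ⟨g • (x : A), hX x x.2⟩ = b.repr z x := by
  have : (Finsupp.lapply (⟨g • (x : A), hX x x.2⟩ : X)) ∘ₗ b.repr.toLinearMap ∘ₗ
      DistribSMul.toLinearMap k A g = Finsupp.lapply x ∘ₗ b.repr.toLinearMap := by
    refine b.ext fun y => ?_
    have e : g • b y = b ⟨g • (y : A), hX y y.2⟩ := by rw [hb, hb]
    simp only [LinearMap.comp_apply, DistribSMul.toLinearMap_apply, e, LinearEquiv.coe_coe,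
      Module.Basis.repr_self, Finsupp.lapply_apply]
    classical
    rw [Finsupp.single_apply, Finsupp.single_apply]
    refine if_congr ?_ rfl rfl
    rw [Subtype.mk.injEq, smul_left_cancel_iff, Subtype.ext_iff]
  exact LinearMap.congr_fun this z

noncomputable instance fixAlgebra (H : Subgroup G) : Algebra k (Fix A H) :=
  inferInstanceAs (Algebra k (FixedPoints.subalgebra k A H))

theorem finite_Fix [Module.Finite k A] (H : Subgroup G) : Module.Finite k (Fix A H) :=
  Module.Finite.of_injective (FixedPoints.subalgebra k A H).val.toLinearMap Subtype.val_injective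

variable [Finite G]

/-- In terms of a `P`-stable basis, the kernel of the Brauer map consists of the elements whose
coefficients at the `P`-fixed basis elements vanish. -/
theorem mem_brKer_iff [CharP k p] {P : Subgroup G} (hp : p.Prime) (hP : IsPGroup p P) {X : Set A}
    [Finite X]
    (b : Module.Basis X k A) (hb : ∀ x, b x = x) (hX : ∀ g ∈ P, ∀ x ∈ X, g • x ∈ X) {z : A}
    (hz : z ∈ Fix A P) :
    z ∈ brKer A P ↔ ∀ x : X, (x : A) ∈ Fix A P → b.repr z x = 0 := by
  have := Fact.mk hp
  constructor
  · intro h x hx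
    have hle : brKer A P ≤ ((Finsupp.lapply x ∘ₗ b.repr.toLinearMap : A →ₗ[k] k) :
        A →+ k).ker := by
      refine brKer_le fun K hK a ha => ?_
      have := Fintype.ofFinite (P ⧸ K.subgroupOf P)
      -- All translates of `a` have the same coefficient at a fixed basis element, so the trace
      -- multiplies it by the index of `K`, a nontrivial power of `p`.
      have hc : ∀ g ∈ P, b.repr (g • a) x = b.repr a x := by
        intro g hg
        rw [← repr_smul_smul b hb (hX g hg) a x]
        congr 2
        exact Subtype.ext (mem_Fix.1 hx g hg).symm
      change b.repr (relTrace K P a) x = 0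
      rw [relTrace, finsum_eq_sum_of_fintype, map_sum, Finsupp.finsetSum_apply,
        Finset.sum_congr rfl fun q _ => hc _ q.out.2, Finset.sum_const, Finset.card_univ,
        ← Nat.card_eq_fintype_card, nsmul_eq_mul]
      obtain ⟨n, hn⟩ := hP.index (K.subgroupOf P)
      have hn0 : n ≠ 0 := by
        rintro rfl
        rw [pow_zero, Subgroup.index_eq_one, Subgroup.subgroupOf_eq_top] at hn
        exact hK.not_ge hn
      have : Nat.card (P ⧸ K.subgroupOf P) = p ^ n := hn
      rw [this, Nat.cast_pow, CharP.cast_eq_zero, zero_pow hn0, zero_mul]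
    exact hle h
  · intro h
    have := Fintype.ofFinite X
    let _ := stableAction hX
    rw [← b.sum_repr z]
    refine sum_mem_brKer (fun x => b.repr z x • b x) ?_ ?_
    · intro r x
      have e : b.repr z (r • x) = b.repr z x := by
        rw [← repr_smul_smul b hb (hX r r.2) z x, mem_Fix.1 hz r r.2]
        rfl
      rw [e, smul_comm, hb, hb]
      rfl
    · intro x hx
      rw [h x (mem_Fix.2 fun g hg => congrArg Subtype.val (hx ⟨g, hg⟩)), zero_smul]
      exact zero_mem _

/-- Basis elements fixed by `P` are fixed by `Q`, so the coefficient condition at `Q` implies the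
one at `P`. -/
theorem IsPPermutation.mem_brKer_mono [CharP k p] (hA : IsPPermutation p k G A) (hp : p.Prime)
    {Q P : Subgroup G} (hQP : Q ≤ P) (hP : IsPGroup p P) {z : A} (hz : z ∈ Fix A P)
    (h : z ∈ brKer A Q) : z ∈ brKer A P := by
  obtain ⟨X, _, b, hb, hX⟩ := hA.exists_stable_basis hP
  rw [mem_brKer_iff hp hP b hb hX hz]
  rw [mem_brKer_iff hp (hP.to_le hQP) b hb (fun g hg => hX g (hQP hg)) (Fix_anti hQP hz)] at h
  exact fun x hx => h x (Fix_anti hQP hx)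

/-- The Brauer map at a normal subgroup `Q` of the `p`-group `P` has a `P`-equivariant section. -/
theorem IsPPermutation.exists_section [CharP k p] (hA : IsPPermutation p k G A) (hp : p.Prime)
    {Q P : Subgroup G} (hQP : Q ≤ P) (hPQ : P ≤ Subgroup.normalizer (Q : Set G))
    (hP : IsPGroup p P) : ∃ s : BrauerQuotient A Q → A,
      (∀ t, ∃ h : s t ∈ Fix A Q, Br Q ⟨s t, h⟩ = t) ∧
      ∀ (g : G) (hg : g ∈ P) (t : BrauerQuotient A Q),
        s ((⟨g, hPQ hg⟩ : Subgroup.normalizer (Q : Set G)) • t) = g • s t := by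
  classical
  obtain ⟨X, _, b, hb, hX⟩ := hA.exists_stable_basis hP
  have := Fintype.ofFinite X
  have hXQ : ∀ g ∈ Q, ∀ x ∈ X, g • x ∈ X := fun g hg => hX g (hQP hg)
  have hQ := hP.to_le hQP
  choose z hz using Br_surjective (A := A) Q
  have hcoef : ∀ u v : Fix A Q, Br Q u = Br Q v → ∀ x : X, (x : A) ∈ Fix A Q →
      b.repr (u : A) x = b.repr (v : A) x := by
    intro u v huv x hx
    have := (mem_brKer_iff hp hQ b hb hXQ (sub_mem u.2 v.2)).1 (Br_eq.1 huv) x hx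
    rwa [map_sub, Finsupp.sub_apply, sub_eq_zero] at this
  -- The section keeps the coefficients at the `Q`-fixed basis elements. By `hcoef` they do not
  -- depend on the chosen lift `z t`, which makes the section equivariant.
  let c : BrauerQuotient A Q → X → k := fun t x =>
    if (x : A) ∈ Fix A Q then b.repr (z t : A) x else 0
  have hmem : ∀ t, ∑ x, c t x • b x ∈ Fix A Q := by
    refine fun t => sum_mem fun x _ => ?_
    by_cases hx : (x : A) ∈ Fix A Q
    · rw [hb, mem_Fix]
      intro g hg
      rw [smul_comm, mem_Fix.1 hx g hg]
    · simp only [c, if_neg hx, zero_smul]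
      exact zero_mem _
  refine ⟨fun t => ∑ x, c t x • b x, fun t => ⟨hmem t, ?_⟩, fun g hg t => ?_⟩
  · rw [← hz t, Br_eq, mem_brKer_iff hp hQ b hb hXQ (sub_mem (hmem _) (z t).2)]
    intro x hx
    rw [hz t, map_sub, Finsupp.sub_apply, b.repr_sum_self]
    simp only [c, if_pos hx, sub_self]
  · let _ := stableAction hX
    have hgn := hPQ hg
    have hfix : ∀ x : A, g • x ∈ Fix A Q ↔ x ∈ Fix A Q := by
      intro x
      refine ⟨fun h => ?_, smul_mem_Fix hgn⟩
      have := smul_mem_Fix (inv_mem hgn) h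
      rwa [inv_smul_smul] at this
    rw [Finset.smul_sum]
    refine (Equiv.sum_comp (MulAction.toPerm (⟨g, hg⟩ : P)) _).symm.trans
      (Finset.sum_congr rfl fun x _ => ?_)
    have hgx : ((MulAction.toPerm (⟨g, hg⟩ : P) x : X) : A) = g • (x : A) := rfl
    rw [smul_comm, hb, hb, hgx]
    congr 1
    by_cases hx : (x : A) ∈ Fix A Q
    · simp only [c, hgx, hfix, if_pos hx]
      have h1 : Br Q (z ((⟨g, hgn⟩ : Subgroup.normalizer (Q : Set G)) • t)) =
          Br Q (conjFix Q ⟨g, hgn⟩ (z t)) := by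
        rw [hz]
        conv_lhs => rw [← hz t]
        rfl
      rw [hcoef _ _ h1 _ (by rw [hgx]; exact (hfix _).2 hx), coe_conjFix]
      exact repr_smul_smul b hb (hX g hg) _ x
    · simp only [c, hgx, hfix, if_neg hx]

/-! ### Blocks of Brauer quotients and inclusion of Brauer pairs -/

theorem exists_blocks_brauerQuotient (k : Type*) [Field k] [Algebra k A] [SMulCommClass G k A]
    [Module.Finite k A] (P : Subgroup G) :
    ∃ S : Finset (BrauerQuotient A P), (∀ e, e ∈ S ↔ IsBlock e) ∧ ∑ e ∈ S, e = 1 := by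
  have := finite_Fix (k := k) (A := A) P
  have : Module.Finite k (BrauerQuotient A P) := Module.Finite.of_surjective
    (Ideal.Quotient.mkₐ k (brauerIdeal A P)).toLinearMap Ideal.Quotient.mk_surjective
  exact exists_blocks k _

theorem IsBlock.smul {Q : Subgroup G} {e : BrauerQuotient A Q} (he : IsBlock e)
    (g : Subgroup.normalizer (Q : Set G)) : IsBlock (g • e) :=
  he.map (MulSemiringAction.toRingEquiv _ _ g)

/-- For `Q` normal in the `p`-group `P` and `Br_P(a) ≠ 0` there is a `P`-stable block `e` of `A(Q)`
and a lift `y` of `e` to `A^P` such that `Br_P(y a) ≠ 0`. -/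
theorem IsPPermutation.exists_stable_block [CharP k p] (hA : IsPPermutation p k G A)
    (hp : p.Prime) {Q P : Subgroup G} (hQP : Q ≤ P) (hPQ : P ≤ Subgroup.normalizer (Q : Set G))
    (hP : IsPGroup p P) {a : A} (ha : a ∈ Fix A P) (hne : a ∉ brKer A P) :
    ∃ e : BrauerQuotient A Q, IsBlock e ∧ ∃ y ∈ Fix A P,
      (∃ h : y ∈ Fix A Q, Br Q ⟨y, h⟩ = e) ∧ y * a ∉ brKer A P := by
  have := hA.finite
  obtain ⟨S, hS, hS1⟩ := exists_blocks_brauerQuotient (A := A) k Q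
  obtain ⟨s, hs, hsg⟩ := hA.exists_section hp hQP hPQ hP
  let _ : MulAction P (BrauerQuotient A Q) := MulAction.compHom _ (Subgroup.inclusion hPQ)
  let act : MulAction P S :=
    { smul := fun g e => ⟨g • (e : BrauerQuotient A Q), (hS _).2 (((hS _).1 e.2).smul _)⟩
      one_smul := fun e => Subtype.ext (one_smul P (e : BrauerQuotient A Q))
      mul_smul := fun g h e => Subtype.ext (mul_smul g h (e : BrauerQuotient A Q)) }
  let _ : SMul P S := act.toSMul
  have hF : ∀ (r : P) (e : S), s ((r • e : S) : BrauerQuotient A Q) = (r : G) • s e :=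
    fun r e => hsg r r.2 e
  by_contra! hcon
  -- Only `P`-stable blocks can contribute modulo proper traces, and `hcon` says that they do not.
  -- But `∑ s e` lifts `1` at `Q`, hence also at `P`, so `a` itself would be in the kernel.
  have h1 : ∑ e : S, s e * a ∈ brKer A P := by
    refine sum_mem_brKer (fun e : S => s e * a) ?_ ?_
    · intro r e
      rw [hF, smul_mul', mem_Fix.1 ha r r.2]
    · intro e he
      refine hcon e ((hS _).1 e.2) _ (mem_Fix.2 fun g hg => ?_) (hs e)
      rw [← hF ⟨g, hg⟩, he]
  have h2 : ∑ e : S, s e ∈ Fix A P := by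
    rw [mem_Fix]
    intro g hg
    rw [Finset.smul_sum]
    exact (Finset.sum_congr rfl fun e _ => (hF ⟨g, hg⟩ e).symm).trans
      (Equiv.sum_comp (MulAction.toPerm (⟨g, hg⟩ : P)) fun e : S => s e)
  have h3 : 1 - ∑ e : S, s e ∈ brKer A Q := by
    choose hmem hBr using hs
    have : Br Q 1 = Br Q (∑ e : S, ⟨s e, hmem e⟩) := by
      rw [map_one, map_sum, ← hS1, ← Finset.sum_coe_sort]
      exact Finset.sum_congr rfl fun e _ => (hBr e).symm
    rw [Br_eq] at this
    simpa using this
  have h4 := mul_mem_brKer_right ha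
    (hA.mem_brKer_mono hp hQP hP (sub_mem (one_mem _) h2) h3)
  rw [sub_mul, one_mul, Finset.sum_mul] at h4
  have := add_mem h4 h1
  rw [sub_add_cancel] at this
  exact hne this

/-- If `y ∈ A^P` lifts the block `e` of `A(Q)` and `Br_P(y c) ≠ 0`, there is a Brauer pair at `P`
that contains `(Q, e)`. -/
theorem IsPPermutation.exists_brauerLE [CharP k p] (hA : IsPPermutation p k G A) (hp : p.Prime)
    {Q P : Subgroup G} (hQP : Q ≤ P) (hP : IsPGroup p P) (c : Fix A (⊤ : Subgroup G))
    {e : BrauerQuotient A Q} (he : IsBlock e) {y : A} (hy : y ∈ Fix A P) (hyQ : y ∈ Fix A Q)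
    (hye : Br Q ⟨y, hyQ⟩ = e) (hne : y * c ∉ brKer A P) :
    ∃ f : BrauerQuotient A P, IsBrauerPair p c P f ∧ BrauerLE e f := by
  have := hA.finite
  -- `Br_P` factors through `Br_Q` on `A^P`, so `Br_P(y)` inherits from `e` that it is idempotent
  -- and central.
  have hmono : ∀ u v : Fix A P, Br Q (res hQP u) = Br Q (res hQP v) → Br P u = Br P v := by
    intro u v h
    rw [Br_eq] at h ⊢
    exact hA.mem_brKer_mono hp hQP hP (u - v).2 h
  set y' : Fix A P := ⟨y, hy⟩
  have hye' : Br Q (res hQP y') = e := hye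
  have hidem : Br P y' * Br P y' = Br P y' := by
    rw [← map_mul]
    exact hmono _ _ (by rw [map_mul, map_mul, hye', he.idem])
  have hcent : Br P y' ∈ Subring.center (BrauerQuotient A P) := by
    rw [Subring.mem_center_iff]
    intro x
    obtain ⟨x, rfl⟩ := Br_surjective P x
    rw [← map_mul, ← map_mul]
    exact hmono _ _ (by rw [map_mul, map_mul, map_mul, map_mul, hye', he.commute])
  have hcent' := Subring.mem_center_iff.1 hcent
  have hne' : Br P y' * Br P (res le_top c) ≠ 0 := by
    rw [← map_mul, Ne, Br_eq_zero]
    exact hne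
  obtain ⟨S, hS, hS1⟩ := exists_blocks_brauerQuotient (A := A) k P
  obtain ⟨f, hfS, hf⟩ : ∃ f ∈ S, Br P y' * Br P (res le_top c) * f ≠ 0 := by
    by_contra! h
    apply hne'
    rw [← mul_one (Br P y' * _), ← hS1, Finset.mul_sum]
    exact Finset.sum_eq_zero h
  have hfb := (hS f).1 hfS
  have hyf : Br P y' * f = f := by
    refine hfb.mul_eq_of_central hcent hidem fun h => hf ?_
    rw [← hcent', mul_assoc, h, mul_zero]
  refine ⟨f, ⟨hP, hfb, fun h => hf (by rw [mul_assoc, h, mul_zero])⟩, hQP, fun i _ hi h => hi ?_⟩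
  -- If `Br_Q(i) e = 0`, then `i y` vanishes at `Q`, hence at `P`; since `f` lies under `Br_P(y)`,
  -- this kills `Br_P(i) f`.
  have : Br P (i * y') = Br P 0 := hmono _ _ (by rw [map_mul, map_mul, hye', h, map_zero, map_zero])
  rw [← hyf, ← mul_assoc, ← map_mul, this, map_zero, zero_mul]

/-- The blocks `e` of `A(Q)` with `Br_Q(c) e ≠ 0` are conjugate under `N_N(Q)`. -/
theorem exists_smul_eq_of_block (k : Type*) [Field k] [Algebra k A] [SMulCommClass G k A]
    [Module.Finite k A] {N Q : Subgroup G} (hQN : Q ≤ N) (c : Fix A (⊤ : Subgroup G))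
    (hc : IsPrimitiveIdem (res (le_top : N ≤ ⊤) c))
    (hcQ : res (le_top : N ≤ ⊤) c ∈ traceIdeal A hQN) {f : BrauerQuotient A Q}
    (hf : IsBlock f) (hcf : Br Q (res le_top c) * f ≠ 0)
    (hf' : IsPrimitiveInCentralizerFixed N Q f) {e : BrauerQuotient A Q} (he : IsBlock e)
    (hce : Br Q (res le_top c) * e ≠ 0) :
    ∃ g : Subgroup.normalizer (Q : Set G), (g : G) ∈ N ∧ g • f = e := by
  classical
  have := finite_Fix (k := k) (A := A) N
  obtain ⟨b, hb, hcb⟩ := hcQ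
  change (c : A) = _ at hcb
  have hcc : c * c = c := by
    have : (c : A) * c = c := congrArg Subtype.val hc.1
    exact Subtype.ext this
  have hcfix : ∀ g : Subgroup.normalizer (Q : Set G),
      g • Br Q (res le_top c) = Br Q (res le_top c) := by
    intro g
    refine congrArg (Br Q) (Subtype.ext ?_ : conjFix Q g (res le_top c) = res le_top c)
    exact mem_Fix.1 c.2 g trivial
  -- `Br_Q(c)` is fixed by `C_N(Q)` and commutes with `f`, so it splits `f` inside the fixed
  -- subring; primitivity there leaves only the nonzero part.
  have hcf1 : Br Q (res le_top c) * f = f := by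
    obtain ⟨hfx, hfp⟩ := hf'
    have hmem : Br Q (res le_top c) ∈ FixedPoints.subring (BrauerQuotient A Q)
      ((Subgroup.centralizer (Q : Set G) ⊓ N).subgroupOf (Subgroup.normalizer (Q : Set G))) :=
      fun g => hcfix g
    have hi : Br Q (res le_top c) * Br Q (res le_top c) = Br Q (res le_top c) := by
      rw [← map_mul, ← map_mul, hcc]
    have hcm := hf.commute (Br Q (res le_top c))
    have hff := hf.idem
    generalize Br Q (res le_top c) = d at *
    have h1 : d * f * (d * f) = d * f := by
      rw [mul_assoc, ← mul_assoc f, hcm, mul_assoc d, hff, ← mul_assoc, hi]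
    have h2 : d * f * f = d * f := by rw [mul_assoc, hff]
    have h3 : f * (d * f) = d * f := by rw [← mul_assoc, hcm, h2]
    rcases hfp.2.2 (⟨d, hmem⟩ * ⟨f, hfx⟩) (⟨f, hfx⟩ - ⟨d, hmem⟩ * ⟨f, hfx⟩) (Subtype.ext h1)
      (Subtype.ext (by
        change (f - d * f) * (f - d * f) = f - d * f
        rw [sub_mul, mul_sub, mul_sub, hff, h1, h2, h3, sub_self, sub_zero]))
      (Subtype.ext (by
        change d * f * (f - d * f) = 0
        rw [mul_sub, h1, h2, sub_self]))
      (Subtype.ext (by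
        change (f - d * f) * (d * f) = 0
        rw [sub_mul, h1, h3, sub_self])) (add_sub_cancel _ _) with h | h
    · exact absurd (congrArg Subtype.val h) hcf
    · exact (sub_eq_zero.1 (congrArg Subtype.val h)).symm
  obtain ⟨S, hS, -⟩ := exists_blocks_brauerQuotient (A := A) k Q
  set T := S.filter fun x => ∃ g : Subgroup.normalizer (Q : Set G), (g : G) ∈ N ∧ g • f = x with hT
  have hTmem : ∀ x, x ∈ T ↔
      IsBlock x ∧ ∃ g : Subgroup.normalizer (Q : Set G), (g : G) ∈ N ∧ g • f = x := fun x => by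
    rw [hT, Finset.mem_filter, hS]
  have hTsmul : ∀ g : Subgroup.normalizer (Q : Set G), (g : G) ∈ N → ∀ x ∈ T, g • x ∈ T := by
    intro g hg x hx
    rw [hTmem] at hx ⊢
    obtain ⟨hxb, h, hh, rfl⟩ := hx
    exact ⟨hxb.smul g, g * h, N.mul_mem hg hh, mul_smul g h f⟩
  have htfix : ∀ g : Subgroup.normalizer (Q : Set G), (g : G) ∈ N →
      g • ∑ x ∈ T, x = ∑ x ∈ T, x := by
    intro g hg
    rw [Finset.smul_sum]
    exact Finset.sum_nbij' (fun x => g • x) (fun x => g⁻¹ • x) (hTsmul g hg)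
      (hTsmul g⁻¹ (N.inv_mem hg)) (fun x _ => inv_smul_smul g x) (fun x _ => smul_inv_smul g x)
      (fun _ _ => rfl)
  have htf : (∑ x ∈ T, x) * f = f := by
    rw [Finset.sum_mul, Finset.sum_eq_single f]
    · exact hf.idem
    · intro x hx hxf
      by_contra h
      exact hxf (((hTmem x).1 hx).1.eq_of_mul_ne_zero hf h)
    · exact fun h => absurd ((hTmem f).2 ⟨hf, 1, N.one_mem, one_smul _ f⟩) h
  have htcomm : ∀ x, (∑ x ∈ T, x) * x = x * ∑ x ∈ T, x := by
    intro x
    rw [Finset.sum_mul, Finset.mul_sum]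
    exact Finset.sum_congr rfl fun y hy => ((hTmem y).1 hy).1.commute x
  set t := ∑ x ∈ T, x with ht
  obtain ⟨w, hw⟩ := Br_surjective Q t
  have hwn : ∀ g ∈ N, g ∈ Subgroup.normalizer (Q : Set G) →
      g • (w : A) - w ∈ brKer A Q := by
    intro g hgN hg
    have := htfix ⟨g, hg⟩ hgN
    rw [← hw] at this
    change Br Q (conjFix Q ⟨g, hg⟩ w) = _ at this
    rwa [Br_eq, coe_conjFix] at this
  have htr := relTrace_mul_sub_mem_brKer hQN w.2 hb hwn
  rw [← hcb] at htr
  set c' : Fix A N := res le_top c with hc'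
  have hcc' : c' * c' = c' := hc.1
  -- With `t` the sum of the `N_N(Q)`-conjugates of `f`, this trace realizes `t Br_Q(c)` by an
  -- element of `A^N`, where locality at `c` applies.
  let a₀ : Fix A N := ⟨relTrace Q N ((w : A) * b), relTrace_mem (mul_mem w.2 hb)⟩
  have hc'Q : Br Q (res hQN c') = Br Q (res le_top c) := rfl
  have ha₀ : Br Q (res hQN a₀) = t * Br Q (res le_top c) := by
    rw [← hw, ← map_mul, Br_eq]
    exact htr
  rcases hc.nilpotent_or_invertible k (a := c' * a₀ * c')
    (by rw [← mul_assoc, ← mul_assoc, hcc']) (by rw [mul_assoc, hcc']) with ⟨n, hn⟩ | ⟨v, hv, -⟩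
  · exfalso
    have h1 := congrArg (fun x => Br Q (res hQN x)) hn
    simp only [map_pow, map_mul, map_zero, hc'Q, ha₀] at h1
    have h2 : ∀ m : ℕ, (Br Q (res le_top c) * (t * Br Q (res le_top c)) *
        Br Q (res le_top c)) ^ m * f = f := by
      intro m
      induction m with
      | zero => rw [pow_zero, one_mul]
      | succ m ih =>
        rw [pow_succ, mul_assoc, mul_assoc _ _ f, hcf1, mul_assoc _ _ f, mul_assoc t, hcf1, htf,
          hcf1, ih]
    apply hf.ne_zero
    rw [← h2 n, h1, zero_mul]
  · have h1 := congrArg (fun x => Br Q (res hQN x)) hv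
    simp only [map_mul, hc'Q, ha₀] at h1
    -- Invertibility makes `Br_Q(c)` a multiple of the central element `t`, so `t e = 0` would give
    -- `Br_Q(c) e = 0`.
    have h2 : t * e ≠ 0 := by
      intro h
      apply hce
      have h3 : Br Q (res le_top c) * (t * Br Q (res le_top c)) =
          t * (Br Q (res le_top c) * Br Q (res le_top c)) := by
        rw [← mul_assoc, ← htcomm, mul_assoc]
      rw [← he.commute, ← h1, h3, mul_assoc t, mul_assoc t, ← mul_assoc e, he.commute t, h,
        zero_mul]
    rw [ht, Finset.sum_mul] at h2
    obtain ⟨x, hx, hxe⟩ := Finset.exists_ne_zero_of_sum_ne_zero h2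
    obtain ⟨hxb, g, hg, hgx⟩ := (hTmem x).1 hx
    exact ⟨g, hg, hgx.trans (hxb.eq_of_mul_ne_zero he hxe)⟩

end Basis

/-! ### Defect groups of primitive idempotents -/

section Defect

theorem IsPoint.isPrimitiveIdem {R : Type*} [Ring R] {α : Set R} (hα : IsPoint α) {i : R}
    (hi : i ∈ α) : IsPrimitiveIdem i := by
  obtain ⟨e, he, rfl⟩ := hα
  obtain ⟨u, rfl⟩ := hi
  exact he.map (MulSemiringAction.toRingEquiv (ConjAct Rˣ) R (ConjAct.toConjAct u))

theorem IsPoint.exists_conj {R : Type*} [Ring R] {α : Set R} (hα : IsPoint α) {i j : R}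
    (hi : i ∈ α) (hj : j ∈ α) : ∃ u : Rˣ, j = u * i * (u⁻¹ : Rˣ) := by
  obtain ⟨e, he, rfl⟩ := hα
  obtain ⟨u, rfl⟩ := hi
  obtain ⟨v, rfl⟩ := hj
  exact ⟨v * u⁻¹, by simp [mul_assoc]⟩

variable {G : Type*} [Group G] [Finite G] {A : Type*} [Ring A] [MulSemiringAction G A]

/-- Trace ideals are two-sided, so one member of a conjugacy class decides for all. -/
theorem isDefectGroup_iff {H : Subgroup G} {α : Set (Fix A H)} (hα : IsPoint α) {i : Fix A H}
    (hi : i ∈ α) (P : Subgroup G) :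
    IsDefectGroup α P ↔ Minimal (fun K : Subgroup G => ∃ h : K ≤ H, i ∈ traceIdeal A h) P := by
  unfold IsDefectGroup
  have : (fun K : Subgroup G => ∃ h : K ≤ H, ∀ j ∈ α, j ∈ traceIdeal A h) =
      fun K : Subgroup G => ∃ h : K ≤ H, i ∈ traceIdeal A h := by
    funext K
    refine propext ⟨fun ⟨h, h'⟩ => ⟨h, h' i hi⟩, fun ⟨h, h'⟩ => ⟨h, fun j hj => ?_⟩⟩
    obtain ⟨u, rfl⟩ := hα.exists_conj hi hj
    exact mul_mem_traceIdeal h (Ideal.mul_mem_left _ _ h') _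
  rw [this]

theorem minimal_conj {i : Fix A (⊤ : Subgroup G)} {P : Subgroup G}
    (hP : Minimal (fun K : Subgroup G => ∃ h : K ≤ ⊤, i ∈ traceIdeal A h) P) (g : G) :
    Minimal (fun K : Subgroup G => ∃ h : K ≤ ⊤, i ∈ traceIdeal A h) (MulAut.conj g • P) := by
  have key : ∀ (g : G) (K : Subgroup G), (∃ h : K ≤ ⊤, i ∈ traceIdeal A h) →
      ∃ h : MulAut.conj g • K ≤ ⊤, i ∈ traceIdeal A h := by
    rintro g K ⟨h, a, ha, hia⟩
    refine ⟨le_top, g • a, smul_mem_Fix_conj g ha, ?_⟩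
    have := relTrace_conj g (H := ⊤) ha
    rw [← hia, Subgroup.conj_smul_eq_self_of_mem (Subgroup.mem_top g),
      mem_Fix.1 i.2 g trivial] at this
    exact this
  refine ⟨key g P hP.1, fun K hK hKP => ?_⟩
  have h1 := key g⁻¹ K hK
  have h2 : MulAut.conj g⁻¹ • K ≤ P := by
    rw [map_inv, ← Subgroup.pointwise_smul_le_pointwise_smul_iff (a := MulAut.conj g),
      smul_inv_smul]
    exact hKP
  have h3 := hP.2 h1 h2
  rwa [map_inv, ← Subgroup.pointwise_smul_le_pointwise_smul_iff (a := MulAut.conj g),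
    smul_inv_smul] at h3

/-- A defect group of a primitive idempotent is a `p`-group. -/
theorem isPGroup_of_minimal (k : Type*) [Field k] [Algebra k A] [SMulCommClass G k A] {p : ℕ}
    [CharP k p] (hp : p.Prime) {H : Subgroup G} {i : Fix A H}
    {P : Subgroup G} (hP : Minimal (fun K : Subgroup G => ∃ h : K ≤ H, i ∈ traceIdeal A h) P) :
    IsPGroup p P := by
  have := Fact.mk hp
  obtain ⟨⟨hPH, a, ha, hia⟩, hmin⟩ := hP
  obtain ⟨S⟩ : Nonempty (Sylow p P) := inferInstance
  set S' : Subgroup G := (S : Subgroup P).map P.subtype with hS'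
  have hS'P : S' ≤ P := Subgroup.map_subtype_le _
  have hsub : S'.subgroupOf P = S := Subgroup.comap_map_eq_self_of_injective P.subtype_injective _
  -- The index of a Sylow subgroup is invertible in `k`, so `a` is the trace of `m⁻¹ a` from it, and
  -- minimality makes `P` equal to that Sylow subgroup.
  set m : ℕ := (S : Subgroup P).index with hm
  have hm0 : (m : k) ≠ 0 := by
    rw [Ne, CharP.cast_eq_zero_iff k p]
    exact S.not_dvd_index
  have hma : (m : k)⁻¹ • a ∈ Fix A P := by
    rw [mem_Fix]
    intro g hg
    rw [smul_comm, mem_Fix.1 ha g hg]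
  have h1 : relTrace S' P ((m : k)⁻¹ • a) = a := by
    rw [relTrace_of_mem_Fix hma, hsub, ← hm, ← Nat.cast_smul_eq_nsmul k, smul_smul,
      mul_inv_cancel₀ hm0, one_smul]
  have h2 : P ≤ S' := by
    refine hmin ⟨hS'P.trans hPH, _, Fix_anti hS'P hma, ?_⟩ hS'P
    rw [← relTrace_relTrace hS'P hPH (Fix_anti hS'P hma), h1, hia]
  have h3 : IsPGroup p S' := S.isPGroup'.map _
  exact h3.to_le h2

/-- The Brauer map at a defect group of a primitive idempotent does not annihilate it. -/
theorem not_mem_brKer_of_minimal (k : Type*) [Field k] [Algebra k A] [SMulCommClass G k A]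
    [Module.Finite k A] {H : Subgroup G} {i : Fix A H}
    (hi : IsPrimitiveIdem i) {P : Subgroup G}
    (hP : Minimal (fun K : Subgroup G => ∃ h : K ≤ H, i ∈ traceIdeal A h) P) :
    (i : A) ∉ brKer A P := by
  intro hbr
  have := finite_Fix (k := k) (A := A) H
  obtain ⟨⟨hPH, a, ha, hia⟩, hmin⟩ := hP
  let I : Ideal (Fix A H) := ⨆ K : {K : Subgroup G // K < P}, traceIdeal A (K.2.le.trans hPH)
  -- `S` consists of the `x` with `Tr_P^H(a x) ∈ I`. It contains proper traces because `Tr_P^H(a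
  -- Tr_K^P(b)) = Tr_K^H(a b)`. For `x = i` the value is `i` itself, so Rosenberg's lemma
  -- contradicts minimality.
  let S : AddSubgroup A := (I.toAddSubgroup.map (Fix A H).subtype.toAddMonoidHom).comap
    (⟨⟨fun x => relTrace P H (a * x), by rw [mul_zero]; simp [relTrace]⟩, fun x y => by
      simp only [mul_add, relTrace_add]⟩ : A →+ A)
  have hle : brKer A P ≤ S := by
    refine brKer_le fun K hK b hb => ?_
    have hab : a * b ∈ Fix A K := mul_mem (Fix_anti hK.le ha) hb
    refine ⟨⟨relTrace K H (a * b), relTrace_mem hab⟩, ?_, ?_⟩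
    · exact Submodule.mem_iSup_of_mem (p := fun K : {K : Subgroup G // K < P} =>
        traceIdeal A (K.2.le.trans hPH)) ⟨K, hK⟩ ⟨_, hab, rfl⟩
    · change relTrace K H (a * b) = relTrace P H (a * relTrace K P b)
      rw [← relTrace_mul_left K ha, relTrace_relTrace hK.le hPH hab]
  obtain ⟨y, hy, hyi⟩ := hle hbr
  have hyi' : (y : A) = relTrace P H (a * i) := hyi
  have : y = i := by
    refine Subtype.ext ?_
    rw [hyi', relTrace_mul_right P i.2, ← hia]
    exact congrArg Subtype.val hi.1
  rw [this] at hy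
  obtain ⟨⟨K, hK⟩, hiK⟩ := hi.exists_mem_of_iSup k _
    (fun K z hz r => mul_mem_traceIdeal _ hz r) hy
  exact hK.not_ge (hmin ⟨hK.le.trans hPH, hiK⟩ hK.le)

end Defect

/-! ### Equivariant maps and the Brauer kernel -/

section Map

variable {G : Type*} [Group G] {A C : Type*} [Ring A] [MulSemiringAction G A]
  [Ring C] [MulSemiringAction G C]

theorem map_mem_Fix (φ : C →+ A) (hφ : ∀ (g : G) (x : C), φ (g • x) = g • φ x)
    {H : Subgroup G} {x : C} (hx : x ∈ Fix C H) : φ x ∈ Fix A H := by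
  rw [mem_Fix]
  intro h hh
  rw [← hφ, mem_Fix.1 hx h hh]

variable [Finite G]

theorem map_relTrace (φ : C →+ A) (hφ : ∀ (g : G) (x : C), φ (g • x) = g • φ x) (K H : Subgroup G)
    (x : C) :
    φ (relTrace K H x) = relTrace K H (φ x) := by
  unfold relTrace
  rw [φ.map_finsum (Set.toFinite _)]
  exact finsum_congr fun q => hφ _ _

/-- Equivariant additive maps commute with traces. Additivity suffices, which suits an inclusion
that need not preserve the identity. -/
theorem map_mem_brKer (φ : C →+ A) (hφ : ∀ (g : G) (x : C), φ (g • x) = g • φ x)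
    {P : Subgroup G} {x : C} (hx : x ∈ brKer C P) : φ x ∈ brKer A P := by
  have : brKer C P ≤ (brKer A P).comap φ := by
    refine brKer_le fun K hK a ha => ?_
    rw [AddSubgroup.mem_comap, map_relTrace φ hφ]
    exact relTrace_mem_brKer hK (map_mem_Fix φ hφ ha)
  exact this hx

end Map

end PermAlg

/-! ### The main theorem -/

open PermAlg in
theorem proposition5p3 {p : ℕ} (hp : p.Prime) {k : Type*} [Field k] [CharP k p]
    {G : Type*} [Group G] [Finite G] (N : Subgroup G) [N.Normal]
    -- `A` and `C` are `p`-permutation `G`-algebras over `k`, and `C` is `N`-interior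
    {A : Type*} [Ring A] [Algebra k A] [MulSemiringAction G A] [SMulCommClass G k A]
    (hA : PermAlg.IsPPermutation p k G A)
    {C : Type*} [Ring C] [Algebra k C] [MulSemiringAction G C] [SMulCommClass G k C]
    (hC : PermAlg.IsPPermutation p k G C) (σ : PermAlg.NInterior N C)
    -- `C` is a `G`-stable subalgebra of `A`, not necessarily with the same identity; being a
    -- subspace it is a direct summand as a `k`-module
    (ι : C →ₙₐ[k] A) (hι : Function.Injective ι) (hιG : ∀ (g : G) (x : C), ι (g • x) = g • ι x)
    -- `c` is a `G`-invariant primitive idempotent of `C^N` with defect group `Q` in `N`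
    (c : PermAlg.Fix C (⊤ : Subgroup G))
    (hc : PermAlg.IsPrimitiveIdem (PermAlg.res (le_top : N ≤ ⊤) c))
    (Q : Subgroup G) (hQ : PermAlg.IsDefectGroup {PermAlg.res (le_top : N ≤ ⊤) c} Q)
    -- `(Q, f_Q)` is a `(C, c, G)`-Brauer pair with `f_Q` primitive in `C(Q)^{C_N(Q)}`
    (fQ : PermAlg.BrauerQuotient C Q) (hfQ : PermAlg.IsBrauerPair p c Q fQ)
    (hfQ' : PermAlg.IsPrimitiveInCentralizerFixed N Q fQ)
    -- `α` is a point of `G` on `A` that covers `c`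
    (α : Set (PermAlg.Fix A (⊤ : Subgroup G))) (hα : PermAlg.IsPoint α)
    (hcov : PermAlg.Covers ι N (c : C) Q α) :
    ∃ P : Subgroup G, PermAlg.IsDefectGroup α P ∧ P ⊓ N = Q ∧
      ∃ fP : PermAlg.BrauerQuotient C P,
        (⟨P, fP⟩ : Σ R : Subgroup G, PermAlg.BrauerQuotient C R) ∈ PermAlg.F₁ p c fQ := by
  have := hA.finite
  have := hC.finite
  let φ : C →+ A := (ι : C →+ A)
  have hφ : ∀ (g : G) (x : C), φ (g • x) = g • φ x := hιG
  obtain ⟨i, hi, ε, hε, hεQ, ⟨hci, -⟩, ⟨f, hf, hif, -⟩, -⟩ := hcov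
  obtain ⟨hQN, hcQ⟩ := hQ.1
  replace hcQ := hcQ _ rfl
  have hiprim := hα.isPrimitiveIdem hi
  -- a defect group `P` of `α` that contains `Q`
  obtain ⟨P₀, hP₀⟩ := exists_minimal_of_wellFoundedLT
    (fun K : Subgroup G => ∃ h : K ≤ ⊤, i ∈ traceIdeal A h)
    ⟨⊤, le_rfl, i, i.2, (relTrace_self i.2).symm⟩
  have hfQker : (f : A) ∉ brKer A Q :=
    not_mem_brKer_of_minimal k (hε.isPrimitiveIdem hf) ((isDefectGroup_iff hε hf Q).1 hεQ)
  have hiQker : (i : A) ∉ brKer A Q := fun h =>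
    hfQker (hif ▸ mul_mem_brKer_right (Fix_anti hQN f.2) h)
  obtain ⟨g, -, hg⟩ : ∃ g ∈ (⊤ : Subgroup G), Q ≤ MulAut.conj g • P₀ := by
    obtain ⟨⟨-, a, ha, hia⟩, -⟩ := hP₀
    exact exists_le_conj_of_not_mem_brKer le_top ha (hia ▸ hiQker)
  have hPmin := minimal_conj hP₀ g
  generalize MulAut.conj g • P₀ = P at hg hPmin
  have hPp : IsPGroup p P := isPGroup_of_minimal k hp hPmin
  have hiP : (i : A) ∉ brKer A P := not_mem_brKer_of_minimal k hiprim hPmin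
  -- If `c` vanished at `R`, so would `i = c i`, and then `i` would vanish at `P`.
  have hker : ∀ R ≤ P, (c : C) ∉ brKer C R := by
    intro R hR h
    refine hiP (hA.mem_brKer_mono hp hR hPp (Fix_anti le_top i.2) ?_)
    rw [← hci]
    exact mul_mem_brKer_right (Fix_anti le_top i.2) (map_mem_brKer φ hφ h)
  -- `P ⊓ N = Q`
  have hPN : P ⊓ N = Q := by
    obtain ⟨b, hb, hcb⟩ := hcQ
    change (c : C) = _ at hcb
    -- `c` is a trace from `Q` that survives at `P ⊓ N`, so `P ⊓ N` lies in a conjugate of `Q`,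
    -- while it also contains `Q`.
    obtain ⟨h, -, hh⟩ := exists_le_conj_of_not_mem_brKer (R := P ⊓ N) inf_le_right hb
      (hcb ▸ hker _ inf_le_left)
    refine (Subgroup.eq_of_le_of_card_ge (le_inf hg hQN) ?_).symm
    refine (Subgroup.card_le_of_le hh).trans_eq ?_
    exact Subgroup.card_map_of_injective (MulAut.conj h).injective
  have hPQ : P ≤ Subgroup.normalizer (Q : Set G) := by
    intro x hx
    rw [Subgroup.mem_normalizer_iff]
    intro y
    rw [← hPN, Subgroup.mem_inf, Subgroup.mem_inf]
    refine and_congr ?_ ?_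
    · rw [P.mul_mem_cancel_right (P.inv_mem hx), P.mul_mem_cancel_left hx]
    · exact (Subgroup.Normal.mem_comm_iff ‹N.Normal›).trans (by rw [inv_mul_cancel_left]) |>.symm
  -- the block of `C(Q)` below a block of `C(P)`
  obtain ⟨e, he, y, hyP, ⟨hyQ, hye⟩, hyc⟩ := hC.exists_stable_block hp hg hPQ hPp
    (Fix_anti le_top c.2) (hker P le_rfl)
  have hce : Br Q (res le_top c) * e ≠ 0 := by
    rw [← he.commute, ← hye, ← map_mul, Ne, Br_eq_zero]
    exact fun h => hyc (hC.mem_brKer_mono hp hg hPp (mul_mem hyP (Fix_anti le_top c.2)) h)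
  obtain ⟨x, hxN, hx⟩ := exists_smul_eq_of_block k hQN c hc hcQ hfQ.2.1 hfQ.2.2 hfQ' he hce
  -- conjugation moves this block to `fQ`
  have hxQ : MulAut.conj (x⁻¹ : G) • Q = Q :=
    Subgroup.mem_normalizer_iff_map_conj_eq.1 (inv_mem x.2)
  have hfin := hC.exists_brauerLE (P := MulAut.conj (x⁻¹ : G) • P) hp (e := fQ)
    (hxQ.ge.trans (Subgroup.pointwise_smul_le_pointwise_smul_iff.2 hg))
    (hPp.map _) c hfQ.2.1 (y := (x⁻¹ : G) • y) (smul_mem_Fix_conj _ hyP)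
    (smul_mem_Fix (inv_mem x.2) hyQ)
    (by
      rw [← inv_smul_eq_iff.2 hx.symm, ← hye]
      rfl)
    (by
      have h1 : (x⁻¹ : G) • (c : C) = c := mem_Fix.1 c.2 _ trivial
      rw [← h1, ← smul_mul', smul_mem_brKer_iff]
      exact hyc)
  obtain ⟨fP, hfP, hle⟩ := hfin
  refine ⟨MulAut.conj (x⁻¹ : G) • P, (isDefectGroup_iff hα hi _).2 (minimal_conj hPmin _), ?_, fP,
    hfP, hle⟩
  refine Eq.trans ?_ hxQ
  -- As `x ∈ N`, conjugation by `x⁻¹` preserves `N` and so carries `P ⊓ N = Q` along with `P`.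
  rw [← Subgroup.conj_smul_eq_self_of_mem (N.inv_mem hxN), ← Subgroup.smul_inf, hPN]
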